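/- **Setting.** Let $T\ge 1$ and $0<\epsilon<1/2$. A set $x^{(1)},\dots,x^{(n)}\in\mathbb R^T$ is an $\epsilon$-corrupted version of $c^{(1)},\dots,c^{(n)}$ if $x^{(j)}\ne c^{(j)}$ for at most $\epsilon n$ indices $j$. In the online setting the coordinates $x^{(1)}_t,\dots,x^{(n)}_t$ are revealed in round $t=1,\dots,T$, after which the algorithm must output $\mu_t\in\mathbb R$ (using only rounds $1,\dots,t$ and its own randomness). The algorithm robustly estimates the mean $\mu^*$ of a distribution $X$ on $\mathbb R^T$ under $\epsilon$-corruption with error $\epsilon'$ and failure probability $\tau$ if, for i.i.d. clean samples $c^{(1)},\dots,c^{(n)}$ from $X$, with probability at least $1-\tau$ over the clean samples and the algorithm's randomness, every $\epsilon$-corrupted version of the clean samples leads to outputs with $\|\mu-\mu^*\|_2\le\epsilon'$. Let $F:(0,\infty)\to[0,1]$ be monotonically decreasing (not necessarily strictly) and such that $$Q_{F,\epsilon}=\int_0^\infty\min\bigl(\epsilon,\sqrt{\epsilon F(q)}\bigr)\,dq$$ converges. Put $$L=\inf\Bigl\{z\ge 0:\int_z^\infty F(q)\,dq\le Q_{F,\epsilon}/\sqrt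 T\Bigr\},$$ $m=\lfloor L\sqrt T/Q_{F,\epsilon}\rfloor$ (with $m=0$ if $Q_{F,\epsilon}=0$), and $q_i=iL/m$ for $1\le i\le m$. (If $L>0$ then $F(L)>0$. If $L=0$ then $m=0$, the algorithm below outputs $0$, and the value assigned to $F(0)$ is immaterial.) **Binary-Product-Estimation** with parameter $\gamma$, on bits $y^{(j)}_t\in\{0,1\}$: independently for all $j,t$, replace $y^{(j)}_t$ by $1$ with probability $\gamma/4$, by $0$ with probability $1/2-\gamma/4$, and leave it unchanged otherwise. In round $t$, group the samples $j\in[n]$ according to their (noisy) bits in rounds $1,\dots,t-1$; the estimate of a group is the minimum of $\gamma$ and the mean of its (noisy) round-$t$ bits; let $M_t$ be the (lower) median of the group estimates, weighted by group sizes; output $2M_t-\gamma/2$. **Non-parametric-Estimation**: for each $i\in\{1,\dots,m\}$, run Binary-Product-Estimation with $\gamma=F(q_i)$, with independent noise, on the bits $\mathbf 1\{x^{(j)}_t\ge q_i\}$, with outputs $\tilde Y(q_i)_t$, and on the bits $\mathbf 1\{x^{(j)}_t\le -q_i\}$, with outputs $\tilde Y(-q_i)_t$. In round $t$ output $$\mu_t=\sum_{i=1}^m\tilde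 Y(q_i)_t\cdot\frac Lm-\sum_{i=1}^m\tilde Y(-q_i)_t\cdot\frac Lm .$$ **Theorem.** There are universal constants $\epsilon_0,C,K>0$ and $k\in\mathbb N$ such that the following holds for all $T\ge1$, $0<\epsilon\le\epsilon_0$, $\tau\in(0,1)$ and all $F$ as above. Let $X=(X_1,\dots,X_T)$ have independent coordinates with $\Pr[|X_t|\ge q]\le F(q)$ for all $q>0$ and all $t$. Then, for every number of samples $$n\ \ge\ K\cdot 2^T\cdot\Bigl(T\cdot\frac1\epsilon\cdot\frac1{F(L)}\Bigr)^k\cdot\max\Bigl\{1,\ \log\frac{L}{Q_{F,\epsilon}\,\tau}\Bigr\}$$ (and for every $n\ge 0$ if $L=0$), Non-parametric-Estimation robustly estimates the mean of $X$ under $\epsilon$-corruption in the online setting with error $C\cdot Q_{F,\epsilon}$ and failure probability $\tau$. -/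

import Mathlib

open MeasureTheory ProbabilityTheory

namespace OnlineRobustMean

noncomputable section

/-! ### The online model -/

/-- A (possibly randomized) online estimator for `T` rounds and `n` samples, one real coordinate
being revealed per sample and round.  The seed is drawn from `law`, independently of the data.
In round `t` the estimator sees the coordinates of rounds `s ≤ t` of every sample, and nothing
else of the data. -/
structure OnlineEstimator (T n : ℕ) where
  Seed : Type
  [measurableSeed : MeasurableSpace Seed]
  law : Measure Seed
  [probLaw : IsProbabilityMeasure law]
  out : Seed → (t : Fin T) → (Fin n → {s : Fin T // s ≤ t} → ℝ) → ℝ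

attribute [instance] OnlineEstimator.measurableSeed OnlineEstimator.probLaw

/-- The vector of the `T` outputs on seed `ω` and samples `x 0, …, x (n - 1)`. -/
def OnlineEstimator.run {T n : ℕ} (A : OnlineEstimator T n) (ω : A.Seed)
    (x : Fin n → Fin T → ℝ) (t : Fin T) : ℝ :=
  A.out ω t (fun j s => x j s.1)

/-- Strong contamination: `x` arises from `c` by replacing at most `ε n` of the `n` samples by
arbitrary points. -/
def IsCorruption {T n : ℕ} (ε : ℝ) (c x : Fin n → Fin T → ℝ) : Prop :=
  (Set.ncard {j : Fin n | x j ≠ c j} : ℝ) ≤ ε * n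

/-- The coordinatewise mean. -/
def mean {T : ℕ} (P : Measure (Fin T → ℝ)) (t : Fin T) : ℝ := ∫ x, x t ∂P

/-- The estimator `A` robustly estimates the mean of `P` under `ε`-corruption with error `err`
and failure probability `τ`: the clean samples are i.i.d. from `P`; outside an event of probability
at most `τ` (over clean samples and seed), *every* `ε`-corrupted version `x` of
the clean samples, hence every one that an adversary can choose after observing them, leads to
outputs within Euclidean distance `err` of the mean. The measure of the failure set is an outer
measure, so no measurability of the adversary's choice is involved. -/
def RobustlyEstimatesMean {T n : ℕ} (A : OnlineEstimator T n) (P : Measure (Fin T → ℝ))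
    (ε err τ : ℝ) : Prop :=
  ((Measure.pi fun _ : Fin n => P).prod A.law)
    {z | ∃ x : Fin n → Fin T → ℝ, IsCorruption ε z.1 x ∧
      err < Real.sqrt (∑ t, (A.run z.2 x t - mean P t) ^ 2)} ≤ ENNReal.ofReal τ

/-! ### `F`-tail bound product distributions -/

/-- `P` is the law of a vector with independent coordinates `X_t` such that
`Pr[|X_t| ≥ q] ≤ F q` for all `t` and all `q > 0`. -/
structure IsTailBoundProduct {T : ℕ} (F : ℝ → ℝ) (P : Measure (Fin T → ℝ)) : Prop where
  prob : IsProbabilityMeasure P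
  indep : iIndepFun (fun (t : Fin T) (x : Fin T → ℝ) => x t) P
  tail : ∀ (t : Fin T) (q : ℝ), 0 < q → P {x | q ≤ |x t|} ≤ ENNReal.ofReal (F q)

/-- `Q_{F,ε}`, the integral of `min (ε, √(ε F(q)))` over `q > 0`. -/
def tailQ (F : ℝ → ℝ) (ε : ℝ) : ℝ :=
  ∫ q in Set.Ioi (0 : ℝ), min ε (Real.sqrt (ε * F q))

/-- `L`, the infimum of all `z ≥ 0` for which the integral of `F` over `(z, ∞)` is at most
`Q_{F,ε} / √T`. -/
def tailL (F : ℝ → ℝ) (ε : ℝ) (T : ℕ) : ℝ :=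
  sInf {z : ℝ | 0 ≤ z ∧ ∫ q in Set.Ioi z, F q ≤ tailQ F ε / Real.sqrt T}

/-- The number `m = ⌊L √T / Q_{F,ε}⌋` of thresholds. -/
def numThresholds (F : ℝ → ℝ) (ε : ℝ) (T : ℕ) : ℕ :=
  ⌊tailL F ε T * Real.sqrt T / tailQ F ε⌋₊

/-- The threshold `q_{i+1}`, where `q_0, …, q_m` cut `[0, L]` into `m` equal intervals. -/
def threshold (F : ℝ → ℝ) (ε : ℝ) (T : ℕ) (i : Fin (numThresholds F ε T)) : ℝ :=
  ((i : ℝ) + 1) * (tailL F ε T / numThresholds F ε T)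

/-! ### Binary product estimation -/

/-- The noise added to a bit `b`: it becomes `1` with probability `γ / 4`, becomes `0` with
probability `1 / 2 - γ / 4`, and is left unchanged otherwise (`u` is uniform on `[0, 1]`). -/
def addNoise (γ : ℝ) (u : unitInterval) (b : Bool) : Bool :=
  if (u : ℝ) ≤ γ / 4 then true else if (u : ℝ) ≤ 1 / 2 then false else b

/-- The group of all samples whose bits in the rounds before `t` form the pattern `p`. -/
def group {T n : ℕ} {t : Fin T} (y : Fin n → {s : Fin T // s ≤ t} → Bool)
    (p : {s : Fin T // s < t} → Bool) : Finset (Fin n) :=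
  Finset.univ.filter fun j => ∀ s : {s : Fin T // s < t}, y j ⟨s.1, s.2.le⟩ = p s

/-- The group estimate: the mean of the round-`t` bits in the group, capped by `γ`. (An empty
group has weight zero below, so its value is immaterial.) -/
def groupEstimate {T n : ℕ} {t : Fin T} (γ : ℝ) (y : Fin n → {s : Fin T // s ≤ t} → Bool)
    (p : {s : Fin T // s < t} → Bool) : ℝ :=
  min γ ((((group y p).filter fun j => y j ⟨t, le_rfl⟩ = true).card : ℝ) / ((group y p).card : ℝ))

/-- The (lower) median of the values `v i` with weights `w i`. -/
def weightedMedian {ι : Type*} [Fintype ι] (w v : ι → ℝ) : ℝ :=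
  sInf {r : ℝ | (∑ i, w i) / 2 ≤ ∑ i ∈ Finset.univ.filter (fun i => v i ≤ r), w i}

/-- Round `t` of the weighted-median-of-groups estimator, on bits without added noise. -/
def medianOfGroups {T n : ℕ} {t : Fin T} (γ : ℝ)
    (y : Fin n → {s : Fin T // s ≤ t} → Bool) : ℝ :=
  weightedMedian (fun p => ((group y p).card : ℝ)) (groupEstimate γ y)

/-- Round `t` of Binary-Product-Estimation with bound `γ` on the coordinate means: noise is added
to the bits, the median of groups is computed, and the affine change of the mean made by the
noise, `μ ↦ μ / 2 + γ / 4`, is undone. -/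
def binaryProductEstimation {T n : ℕ} {t : Fin T} (γ : ℝ) (u : Fin n → Fin T → unitInterval)
    (y : Fin n → {s : Fin T // s ≤ t} → Bool) : ℝ :=
  2 * medianOfGroups γ (fun j s => addNoise γ (u j s.1) (y j s)) - γ / 2

/-! ### Non-parametric estimation -/

/-- Non-parametric-Estimation. For each threshold `q`, one copy of binary product estimation with
bound `F q` is run on the bits `1{X_t ≥ q}` and one on the bits `1{X_t ≤ -q}`, each with its own
independent uniform noise variables (the first with the flag `true`, the second with `false`);
round `t` outputs the difference of the two Riemann sums. -/
def nonParametricEstimation (F : ℝ → ℝ) (ε : ℝ) (T n : ℕ) : OnlineEstimator T n where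
  Seed := Fin (numThresholds F ε T) → Bool → Fin n → Fin T → unitInterval
  law := volume
  out ω _ x :=
    (∑ i, binaryProductEstimation (F (threshold F ε T i)) (ω i true)
        (fun j s => decide (threshold F ε T i ≤ x j s))
        * (tailL F ε T / numThresholds F ε T))
    - ∑ i, binaryProductEstimation (F (threshold F ε T i)) (ω i false)
        (fun j s => decide (x j s ≤ -threshold F ε T i))
        * (tailL F ε T / numThresholds F ε T)

end

end OnlineRobustMean

/-! Binary estimation is analysed through a likelihood ratio martingale. The noise moves a bit mean
`p ≤ γ` to `r = γ/4 + p/2`, which lies in `[γ/4, 3γ/4]`. With high probability the empirical law of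
the clean noisy patterns in `{0,1}^T` is within `2ε` of the product law with means `r` in ℓ¹
(Hoeffding for each of the `2^(2^T)` sets of patterns, `measureReal_freq_le`). Corrupting `ε n`
samples moves it by at most `2ε` more, whatever the adversary does. So everything after this point
is deterministic: the law `Q` of the observed patterns is within `η = 4ε` of the product law.

Let `X_k` be the ratio of the `Q`-mass to the product mass of the first `k` bits. It is a martingale
under the product law, and `E|X_k - 1| ≤ η`. If the median in round `t` is off by `δ_t`, then half
of the `Q`-mass lies in groups whose conditional mean is off by at least `δ_t`
(`medianOfGroups_spec`), and on these groups the martingale must move. The movement is measured by a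
Huber potential `E huber s (X_k - 1)`: convexity makes it nondecreasing, it grows quadratically near
`X = 1`, and its final value is at most `2sη` because the Huber function is at most `2s|x|`. Thus
the total gain is at most a constant times `sη` (`sum_gain_le`). Two scales give two rates. The
likely bit `0` with `s` of order `η` gives `∑ δ_t² = O(η²)`; the rare bit `1`, whose relative
deviation is `δ_t / r_t`, with `s = 1` gives `∑ δ_t² = O(ηγ)`. Together each run has error `O(min(ε,
√(εγ)))`.

For real data, the mean is the difference of the integrals of the upper and lower tail
probabilities. The Riemann sum of the run errors at the thresholds is bounded by the integral
`Q_{F,ε}`. The mesh and the truncation at `L` cost `O(Q_{F,ε}/√T)` per coordinate, hence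
`O(Q_{F,ε})` in Euclidean norm. A union bound over the `2m` runs completes the argument. -/

namespace OnlineRobustMean

/-! ### The Huber function -/

/-- The Huber function: `x ^ 2` on `[-s, s]`, continued linearly. -/
noncomputable def huber (s x : ℝ) : ℝ := if |x| ≤ s then x ^ 2 else 2 * s * |x| - s ^ 2

/-- The Huber function is the upper envelope of the tangents of `x ^ 2` with contact point `c` in
`[-s, s]`. Its convexity is used only in this form. -/
theorem huber_ge {s c : ℝ} (hc : |c| ≤ s) (y : ℝ) : 2 * c * y - c ^ 2 ≤ huber s y := by
  unfold huber
  obtain ⟨h1, h2⟩ := abs_le.mp hc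
  split_ifs with h
  · nlinarith [sq_nonneg (y - c)]
  · push Not at h
    rcases abs_cases y with ⟨h3, h4⟩ | ⟨h3, h4⟩ <;> rw [h3] at h ⊢
    · nlinarith [mul_nonneg (sub_nonneg.2 h2) (show 0 ≤ 2 * y - s - c by linarith)]
    · nlinarith [mul_nonneg (show 0 ≤ s + c by linarith) (show 0 ≤ -2 * y - s + c by linarith)]

/-- Existence of a tangent to the Huber function. -/
theorem exists_huber_tangent {s : ℝ} (hs : 0 ≤ s) (x : ℝ) :
    ∃ c, ∀ d, huber s x + c * d ≤ huber s (x + d) := by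
  by_cases h : |x| ≤ s
  · refine ⟨2 * x, fun d => ?_⟩
    have := huber_ge h (x + d)
    rw [show huber s x = x ^ 2 from if_pos h]
    linarith
  · have hx : huber s x = 2 * s * |x| - s ^ 2 := if_neg h
    rcases abs_cases x with ⟨h3, h4⟩ | ⟨h3, h4⟩
    · refine ⟨2 * s, fun d => ?_⟩
      have := huber_ge (abs_of_nonneg hs).le (x + d)
      rw [hx, h3]; linarith
    · refine ⟨-2 * s, fun d => ?_⟩
      have := huber_ge (s := s) (c := -s) (by rw [abs_neg, abs_of_nonneg hs]) (x + d)
      rw [hx, h3]; linarith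

theorem huber_nonneg {s : ℝ} (hs : 0 ≤ s) (x : ℝ) : 0 ≤ huber s x := by
  have := huber_ge (s := s) (c := 0) (by simpa using hs) x
  linarith

theorem huber_le {s : ℝ} (hs : 0 ≤ s) (x : ℝ) : huber s x ≤ 2 * s * |x| := by
  unfold huber
  split_ifs with h
  · rw [← sq_abs]; nlinarith [abs_nonneg x]
  · nlinarith

/-- Strong convexity of the Huber function near the origin. -/
theorem huber_add_ge {s x : ℝ} (hx : |x| ≤ s / 2) (d : ℝ) :
    huber s x + 2 * x * d + min (d ^ 2) (s * |d| / 2) ≤ huber s (x + d) := by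
  have hs : 0 ≤ s := by linarith [abs_nonneg x]
  have h0 : huber s x = x ^ 2 := if_pos (by linarith)
  obtain ⟨h1, h2⟩ := abs_le.mp hx
  rw [h0]
  unfold huber
  split_ifs with h
  · nlinarith [min_le_left (d ^ 2) (s * |d| / 2)]
  · have hm := min_le_right (d ^ 2) (s * |d| / 2)
    push Not at h
    rcases abs_cases (x + d) with ⟨h3, h4⟩ | ⟨h3, h4⟩ <;> rw [h3] at h ⊢
    · have hd : 0 ≤ d := by linarith
      rw [abs_of_nonneg hd] at hm ⊢
      nlinarith [mul_nonneg (show 0 ≤ s - x by linarith) (show 0 ≤ d - (s - x) by linarith),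
        mul_nonneg (show 0 ≤ s - x - s / 2 by linarith) hd]
    · have hd : d ≤ 0 := by linarith
      rw [abs_of_nonpos hd] at hm ⊢
      nlinarith [mul_nonneg (show 0 ≤ s + x by linarith) (show 0 ≤ -d - (s + x) by linarith),
        mul_nonneg (show 0 ≤ s + x - s / 2 by linarith) (neg_nonneg.2 hd)]

/-! ### Finite product distributions on bit patterns -/

section Pattern

variable {T : ℕ}

/-- The probability that a bit with mean `p` equals `v`. -/
noncomputable def bitProb (p : ℝ) (v : Bool) : ℝ := if v then p else 1 - p

theorem sum_bitProb (p : ℝ) : ∑ v, bitProb p v = 1 := by simp [bitProb]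

/-- The probability of a bit pattern under the product distribution with means `r`. -/
noncomputable def patternProb (r : Fin T → ℝ) (a : Fin T → Bool) : ℝ := ∏ t, bitProb (r t) (a t)

/-- The expectation under the product distribution with means `r`. -/
noncomputable def patternExp (r : Fin T → ℝ) (h : (Fin T → Bool) → ℝ) : ℝ :=
  ∑ a, patternProb r a * h a

/-- The probability of the first `k` bits of `a`. -/
noncomputable def prefixProb (r : Fin T → ℝ) (k : ℕ) (a : Fin T → Bool) : ℝ :=
  ∏ t with t.val < k, bitProb (r t) (a t)

/-- The mass given by `Q` to the patterns that agree with `a` on the first `k` bits. -/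
noncomputable def prefixMass (Q : (Fin T → Bool) → ℝ) (k : ℕ) (a : Fin T → Bool) : ℝ :=
  ∑ b with ∀ t : Fin T, t.val < k → b t = a t, Q b

/-- The likelihood ratio of the first `k` bits. -/
noncomputable def prefixRatio (r : Fin T → ℝ) (Q : (Fin T → Bool) → ℝ) (k : ℕ)
    (a : Fin T → Bool) : ℝ :=
  prefixMass Q k a / prefixProb r k a

/-- The increment of the likelihood ratio in round `t` if the bit is `v`. -/
noncomputable def ratioStep (r : Fin T → ℝ) (Q : (Fin T → Bool) → ℝ) (t : Fin T)
    (a : Fin T → Bool) (v : Bool) : ℝ :=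
  prefixRatio r Q (t + 1) (Function.update a t v) - prefixRatio r Q t a

variable {r : Fin T → ℝ} {Q : (Fin T → Bool) → ℝ}

theorem bitProb_pos {p : ℝ} (h0 : 0 < p) (h1 : p < 1) (v : Bool) : 0 < bitProb p v := by
  unfold bitProb; split_ifs <;> linarith

theorem patternProb_pos (hr : ∀ t, 0 < r t ∧ r t < 1) (a : Fin T → Bool) : 0 < patternProb r a :=
  Finset.prod_pos fun t _ => bitProb_pos (hr t).1 (hr t).2 _

theorem prefixProb_pos (hr : ∀ t, 0 < r t ∧ r t < 1) (k : ℕ) (a : Fin T → Bool) :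
    0 < prefixProb r k a :=
  Finset.prod_pos fun t _ => bitProb_pos (hr t).1 (hr t).2 _

theorem patternExp_mono (hr : ∀ t, 0 < r t ∧ r t < 1) {g h : (Fin T → Bool) → ℝ}
    (hgh : ∀ a, g a ≤ h a) : patternExp r g ≤ patternExp r h :=
  Finset.sum_le_sum fun a _ => mul_le_mul_of_nonneg_left (hgh a) (patternProb_pos hr a).le

theorem patternExp_add (g h : (Fin T → Bool) → ℝ) :
    patternExp r (fun a => g a + h a) = patternExp r g + patternExp r h := by
  simp [patternExp, mul_add, Finset.sum_add_distrib]

theorem patternExp_const_mul (c : ℝ) (h : (Fin T → Bool) → ℝ) :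
    patternExp r (fun a => c * h a) = c * patternExp r h := by
  simp only [patternExp, Finset.mul_sum]
  exact Finset.sum_congr rfl fun a _ => by ring

theorem patternProb_update (a : Fin T → Bool) (t : Fin T) (v : Bool) :
    patternProb r (Function.update a t v) * bitProb (r t) (a t)
      = patternProb r a * bitProb (r t) v := by
  unfold patternProb
  rw [← Finset.mul_prod_erase _ _ (Finset.mem_univ t),
    ← Finset.mul_prod_erase _ (fun t => bitProb (r t) (a t)) (Finset.mem_univ t)]
  have : ∏ x ∈ Finset.univ.erase t, bitProb (r x) (Function.update a t v x)
      = ∏ x ∈ Finset.univ.erase t, bitProb (r x) (a x) :=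
    Finset.prod_congr rfl fun x hx => by
      rw [Function.update_of_ne (Finset.ne_of_mem_erase hx)]
  rw [this, Function.update_self]
  ring

/-- Resampling one bit does not change an expectation. -/
theorem patternExp_resample (t : Fin T) (h : (Fin T → Bool) → ℝ) :
    patternExp r h
      = patternExp r fun a => ∑ v, bitProb (r t) v * h (Function.update a t v) := by
  -- Exchanging bit `t` with an independent fresh copy preserves the joint law; as an involution it
  -- reindexes the sum.
  have inv : Function.Involutive
      fun z : (Fin T → Bool) × Bool => (Function.update z.1 t z.2, z.1 t) := by
    rintro ⟨a, v⟩
    simp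
  have key := Equiv.sum_comp inv.toPerm
    fun z : (Fin T → Bool) × Bool => patternProb r z.1 * bitProb (r t) z.2 * h z.1
  rw [Fintype.sum_prod_type, Fintype.sum_prod_type] at key
  have e1 : patternExp r h = ∑ a, ∑ v, patternProb r a * bitProb (r t) v * h a := by
    unfold patternExp
    refine Finset.sum_congr rfl fun a _ => ?_
    rw [← Finset.sum_mul, ← Finset.mul_sum, sum_bitProb, mul_one]
  rw [e1, ← key]
  unfold patternExp
  refine Finset.sum_congr rfl fun a _ => ?_
  rw [Finset.mul_sum]
  refine Finset.sum_congr rfl fun v _ => ?_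
  simp only [Function.Involutive.coe_toPerm]
  rw [patternProb_update, mul_assoc]

theorem prefixProb_succ_update (a : Fin T → Bool) (t : Fin T) (v : Bool) :
    prefixProb r (t + 1) (Function.update a t v) = prefixProb r t a * bitProb (r t) v := by
  unfold prefixProb
  have : (Finset.univ.filter fun s : Fin T => s.val < t + 1)
      = insert t (Finset.univ.filter fun s : Fin T => s.val < t) := by
    ext s; simp [Fin.ext_iff]; omega
  rw [this, Finset.prod_insert (by simp), Function.update_self, mul_comm]
  congr 1
  refine Finset.prod_congr rfl fun s hs => ?_
  have : s ≠ t := by rintro rfl; simp at hs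
  rw [Function.update_of_ne this]

theorem prefixMass_succ_update (a : Fin T → Bool) (t : Fin T) (v : Bool) :
    prefixMass Q (t + 1) (Function.update a t v)
      = ∑ b with (∀ s : Fin T, s.val < t → b s = a s) ∧ b t = v, Q b := by
  unfold prefixMass
  congr 1
  ext b
  simp only [Finset.mem_filter, Finset.mem_univ, true_and]
  constructor
  · intro h
    refine ⟨fun s hs => ?_, by simpa using h t (Nat.lt_succ_self _)⟩
    have : s ≠ t := by rintro rfl; simp at hs
    simpa [Function.update_of_ne this] using h s (by omega)
  · rintro ⟨h1, h2⟩ s hs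
    by_cases hst : s = t
    · subst hst; simpa using h2
    · rw [Function.update_of_ne hst]
      exact h1 s (by have := Fin.val_ne_of_ne hst; omega)

theorem sum_prefixMass_update (a : Fin T → Bool) (t : Fin T) :
    ∑ v, prefixMass Q (t + 1) (Function.update a t v) = prefixMass Q t a := by
  simp only [prefixMass_succ_update, Fintype.sum_bool]
  unfold prefixMass
  rw [← Finset.sum_filter_add_sum_filter_not
    (Finset.univ.filter fun b : Fin T → Bool => ∀ s : Fin T, s.val < t → b s = a s)
    (fun b => b t = true), Finset.filter_filter, Finset.filter_filter]
  simp only [Bool.not_eq_true]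

/-- The likelihood ratio is a martingale. -/
theorem sum_prefixRatio_update (hr : ∀ t, 0 < r t ∧ r t < 1) (a : Fin T → Bool) (t : Fin T) :
    ∑ v, bitProb (r t) v * prefixRatio r Q (t + 1) (Function.update a t v)
      = prefixRatio r Q t a := by
  unfold prefixRatio
  rw [← sum_prefixMass_update a t, Finset.sum_div]
  refine Finset.sum_congr rfl fun v _ => ?_
  rw [prefixProb_succ_update]
  have := (prefixProb_pos hr t a).ne'
  have := (bitProb_pos (hr t).1 (hr t).2 v).ne'
  field_simp

theorem prefixRatio_full (a : Fin T → Bool) : prefixRatio r Q T a = Q a / patternProb r a := by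
  have h1 : prefixProb r T a = patternProb r a := by simp [prefixProb, patternProb]
  have h2 : prefixMass Q T a = Q a := by
    unfold prefixMass
    rw [show (Finset.univ.filter fun b : Fin T → Bool => ∀ t : Fin T, t.val < T → b t = a t) = {a}
      by ext b; simp [funext_iff], Finset.sum_singleton]
  rw [prefixRatio, h1, h2]

/-- Testing the likelihood ratio against a function of the first `k` bits. -/
theorem patternExp_mul_prefixRatio (hr : ∀ t, 0 < r t ∧ r t < 1) {g : (Fin T → Bool) → ℝ} {k : ℕ}
    (hk : k ≤ T) (hg : ∀ (t : Fin T) (v : Bool) a, k ≤ t → g (Function.update a t v) = g a) :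
    patternExp r (fun a => g a * prefixRatio r Q k a) = ∑ a, g a * Q a := by
  -- By the martingale property, `k` can be raised to `T`, where the ratio is the density of `Q`
  -- itself.
  have step : ∀ l, k ≤ l → l ≤ T →
      patternExp r (fun a => g a * prefixRatio r Q k a)
        = patternExp r (fun a => g a * prefixRatio r Q l a) := by
    intro l hkl
    induction l, hkl using Nat.le_induction with
    | base => intro _; rfl
    | succ l hl ih =>
      intro hlT
      rw [ih (by omega), patternExp_resample ⟨l, hlT⟩ (fun a => g a * prefixRatio r Q (l + 1) a)]
      congr 1
      ext a
      have := sum_prefixRatio_update (Q := Q) hr a ⟨l, hlT⟩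
      simp only at this
      rw [← this, Finset.mul_sum]
      refine Finset.sum_congr rfl fun v _ => ?_
      rw [hg _ _ _ hl]
      ring
  rw [step T hk le_rfl]
  unfold patternExp
  refine Finset.sum_congr rfl fun a _ => ?_
  have := (patternProb_pos hr a).ne'
  simp only [prefixRatio_full]
  field_simp

/-- At `k = T` this is an equality. Conditioning on fewer bits can only decrease the left side, by
the triangle inequality for the martingale average. -/
theorem patternExp_abs_prefixRatio_sub_one_le (hr : ∀ t, 0 < r t ∧ r t < 1) {k : ℕ} (hk : k ≤ T) :
    patternExp r (fun a => |prefixRatio r Q k a - 1|) ≤ ∑ a, |Q a - patternProb r a| := by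
  induction hk using Nat.decreasingInduction with
  | self =>
    refine (Finset.sum_congr rfl fun a _ => ?_).le
    have hp := patternProb_pos hr a
    have hq : Q a - patternProb r a = patternProb r a * (prefixRatio r Q T a - 1) := by
      rw [prefixRatio_full]
      field_simp
    rw [hq, abs_mul, abs_of_pos hp]
  | of_succ l hl ih =>
    refine le_trans ?_ ih
    rw [patternExp_resample ⟨l, hl⟩ (fun a => |prefixRatio r Q (l + 1) a - 1|)]
    refine patternExp_mono hr fun a => ?_
    have h1 := sum_prefixRatio_update (Q := Q) hr a ⟨l, hl⟩
    simp only at h1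
    have h2 : prefixRatio r Q l a - 1
        = ∑ v, bitProb (r ⟨l, hl⟩) v *
          (prefixRatio r Q (l + 1) (Function.update a ⟨l, hl⟩ v) - 1) := by
      simp only [mul_sub, Finset.sum_sub_distrib, mul_one, sum_bitProb, h1]
    rw [h2]
    refine (Finset.abs_sum_le_sum_abs _ _).trans (Finset.sum_le_sum fun v _ => ?_)
    rw [abs_mul, abs_of_pos (bitProb_pos (hr _).1 (hr _).2 v)]

/-- One step of the Huber potential. -/
theorem huber_step (hr : ∀ t, 0 < r t ∧ r t < 1) {s : ℝ} (hs : 0 ≤ s) (t : Fin T)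
    (a : Fin T → Bool) {G : ℝ}
    (hG : G ≤ 0 ∨ |prefixRatio r Q t a - 1| ≤ s / 2 ∧ ∃ v,
      G ≤ bitProb (r t) v *
        min (ratioStep r Q t a v ^ 2) (s * |ratioStep r Q t a v| / 2)) :
    huber s (prefixRatio r Q t a - 1) + G
      ≤ ∑ v, bitProb (r t) v * huber s (prefixRatio r Q (t + 1) (Function.update a t v) - 1) := by
  set x := prefixRatio r Q t a - 1 with hx
  set d : Bool → ℝ := ratioStep r Q t a with hd
  have hsum : ∑ v, bitProb (r t) v * d v = 0 := by
    simp only [hd, ratioStep, mul_sub, Finset.sum_sub_distrib, ← Finset.sum_mul, sum_bitProb,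
      sum_prefixRatio_update hr]
    ring
  have hxd : ∀ v, prefixRatio r Q (t + 1) (Function.update a t v) - 1 = x + d v := fun v => by
    simp only [hx, hd, ratioStep]; ring
  simp only [hxd]
  have hb : ∀ v, 0 < bitProb (r t) v := bitProb_pos (hr t).1 (hr t).2
  have hone := sum_bitProb (r t)
  rcases hG with hG | ⟨hxs, v₀, hv₀⟩
  -- Without a gain to show, this is Jensen's inequality.
  · obtain ⟨c, hc⟩ := exists_huber_tangent hs x
    calc huber s x + G ≤ huber s x := by linarith
      _ = ∑ v, bitProb (r t) v * (huber s x + c * d v) := by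
        have : ∀ v, bitProb (r t) v * (huber s x + c * d v)
            = bitProb (r t) v * huber s x + c * (bitProb (r t) v * d v) := fun v => by ring
        simp only [this, Finset.sum_add_distrib, ← Finset.sum_mul, ← Finset.mul_sum, hone, hsum]
        ring
      _ ≤ _ := Finset.sum_le_sum fun v _ => mul_le_mul_of_nonneg_left (hc _) (hb v).le
  -- The linear terms average to zero by `hsum`; of the remaining nonnegative terms only that of
  -- `v₀` is kept.
  · have hmin : ∀ v, 0 ≤ bitProb (r t) v * min (d v ^ 2) (s * |d v| / 2) := fun v =>
      mul_nonneg (hb v).le (le_min (sq_nonneg _) (by positivity))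
    calc huber s x + G
        ≤ huber s x + ∑ v, bitProb (r t) v * min (d v ^ 2) (s * |d v| / 2) := by
          have := Finset.single_le_sum (fun v _ => hmin v) (Finset.mem_univ v₀)
          linarith
      _ = ∑ v, bitProb (r t) v * (huber s x + 2 * x * d v + min (d v ^ 2) (s * |d v| / 2)) := by
        have : ∀ v, bitProb (r t) v * (huber s x + 2 * x * d v + min (d v ^ 2) (s * |d v| / 2))
            = bitProb (r t) v * huber s x + 2 * x * (bitProb (r t) v * d v)
              + bitProb (r t) v * min (d v ^ 2) (s * |d v| / 2) := fun v => by ring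
        simp only [this, Finset.sum_add_distrib, ← Finset.sum_mul, ← Finset.mul_sum, hone, hsum]
        ring
      _ ≤ _ := Finset.sum_le_sum fun v _ =>
        mul_le_mul_of_nonneg_left (huber_add_ge hxs _) (hb v).le

/-- If in every round a set of prefixes of `Q`-mass at least `1 / 2` forces the likelihood ratio to
move, then the total movement is controlled by the distance of `Q` to the product distribution. -/
theorem sum_gain_le (hr : ∀ t, 0 < r t ∧ r t < 1) {s η : ℝ} (hs : 0 < s) (hη : ∑ a, |Q a - patternProb r a| ≤ η) (hη8 : η ≤ 1 / 8)
    (hηs : 16 * η ≤ s) (g : Fin T → ℝ) (hg : ∀ t, 0 ≤ g t) (A : Fin T → (Fin T → Bool) → Prop)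
    [∀ t, DecidablePred (A t)]
    (hA : ∀ (t u : Fin T) (v : Bool) a, t ≤ u → (A t (Function.update a u v) ↔ A t a))
    (hmass : ∀ t, 1 / 2 ≤ ∑ a with A t a, Q a)
    (hgain : ∀ t a, A t a → |prefixRatio r Q t a - 1| ≤ s / 2 → ∃ v,
      g t ≤ bitProb (r t) v *
        min (ratioStep r Q t a v ^ 2) (s * |ratioStep r Q t a v| / 2)) :
    ∑ t, g t ≤ 8 * s * η := by
  set Φ : ℕ → ℝ := fun k => patternExp r fun a => huber s (prefixRatio r Q k a - 1) with hΦ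
  -- The factor `1/4` is the product probability of the event that `A t` holds and the ratio is
  -- still within `s / 2` of `1`.
  have hstep : ∀ t : Fin T, Φ t + g t / 4 ≤ Φ (t + 1) := by
    intro t
    classical
    set B : (Fin T → Bool) → ℝ := fun a =>
      if A t a ∧ |prefixRatio r Q t a - 1| ≤ s / 2 then 1 else 0 with hB
    have h1 : Φ t + g t * patternExp r B ≤ Φ (t + 1) := by
      simp only [hΦ]
      rw [patternExp_resample t (fun a => huber s (prefixRatio r Q (t + 1) a - 1)),
        ← patternExp_const_mul, ← patternExp_add]
      refine patternExp_mono hr fun a => huber_step hr hs.le t a ?_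
      simp only [hB]
      split_ifs with h
      · right
        rw [mul_one]
        exact ⟨h.2, hgain t a h.1 h.2⟩
      · left; simp
    have hdev := (patternExp_abs_prefixRatio_sub_one_le (Q := Q) hr t.2.le).trans hη
    -- Change of measure and Markov's inequality in one pointwise bound: `|X - 1|` pays for
    -- replacing `X` by `1`, and `(2/s)|X - 1| ≥ 1` where `X` is farther than `s / 2` from `1`. The
    -- left side becomes the `Q`-mass of `A t`.
    have h2 : patternExp r (fun a => (if A t a then 1 else 0) * prefixRatio r Q t a)
        ≤ patternExp r B + (1 + 2 / s) * patternExp r (fun a => |prefixRatio r Q t a - 1|) := by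
      rw [← patternExp_const_mul, ← patternExp_add]
      refine patternExp_mono hr fun a => ?_
      have h3 := le_abs_self (prefixRatio r Q t a - 1)
      have h4 := abs_nonneg (prefixRatio r Q t a - 1)
      have h5 : 0 ≤ 2 / s * |prefixRatio r Q t a - 1| := by positivity
      simp only [hB]
      by_cases hAt : A t a
      · by_cases hx : |prefixRatio r Q t a - 1| ≤ s / 2
        · simp [hAt, hx]; linarith
        · simp only [hAt, hx, if_true, and_false, if_false]
          have : 1 ≤ 2 / s * |prefixRatio r Q t a - 1| := by
            rw [div_mul_eq_mul_div, le_div_iff₀ hs]; linarith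
          linarith
      · simp [hAt]; nlinarith
    rw [patternExp_mul_prefixRatio hr t.2.le
      (fun u v a htu => by simp only [hA t u v a htu])] at h2
    have h6 : ∑ a, (if A t a then (1 : ℝ) else 0) * Q a = ∑ a with A t a, Q a := by
      rw [Finset.sum_filter]; exact Finset.sum_congr rfl fun a _ => by split_ifs <;> simp
    have h7 : 1 / 2 ≤ ∑ a with A t a, Q a := hmass t
    have hη0 : 0 ≤ η := le_trans (Finset.sum_nonneg fun a _ => abs_nonneg _) hη
    have h8 : (1 + 2 / s) * patternExp r (fun a => |prefixRatio r Q t a - 1|) ≤ 1 / 4 := by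
      calc _ ≤ (1 + 2 / s) * η := by gcongr
        _ = η + 2 * η / s := by ring
        _ ≤ 1 / 8 + 1 / 8 := by
          refine add_le_add hη8 ?_
          rw [div_le_iff₀ hs]; linarith
        _ = 1 / 4 := by norm_num
    have h9 : 1 / 4 ≤ patternExp r B := by linarith
    nlinarith [hg t]
  have htel : ∑ t, g t / 4 ≤ Φ T - Φ 0 := by
    rw [← Finset.sum_range_sub, ← Fin.sum_univ_eq_sum_range (fun k => Φ (k + 1) - Φ k)]
    exact Finset.sum_le_sum fun t _ => by linarith [hstep t]
  have h0 : 0 ≤ Φ 0 := Finset.sum_nonneg fun a _ =>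
    mul_nonneg (patternProb_pos hr a).le (huber_nonneg hs.le _)
  have hT : Φ T ≤ 2 * s * η := by
    calc Φ T ≤ patternExp r fun a => 2 * s * |prefixRatio r Q T a - 1| :=
          patternExp_mono hr fun a => huber_le hs.le _
      _ = 2 * s * patternExp r fun a => |prefixRatio r Q T a - 1| := patternExp_const_mul _ _
      _ ≤ 2 * s * η := by
        gcongr
        exact (patternExp_abs_prefixRatio_sub_one_le hr le_rfl).trans hη
  rw [← Finset.sum_div] at htel
  linarith

end Pattern

/-! ### From deviating conditional means to the two square-summability rates. -/

section Deviation

variable {T : ℕ} {r : Fin T → ℝ} {Q : (Fin T → Bool) → ℝ}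

/-- The conditional mean under `Q` of bit `t` given that the previous bits are those of `a`. -/
noncomputable def condMean (Q : (Fin T → Bool) → ℝ) (t : Fin T) (a : Fin T → Bool) : ℝ :=
  prefixMass Q (t + 1) (Function.update a t true) / prefixMass Q t a

theorem forall_lt_update_iff {t u : Fin T} (htu : t ≤ u) (v : Bool) (a b : Fin T → Bool) :
    (∀ s : Fin T, s.val < t → b s = Function.update a u v s) ↔
      ∀ s : Fin T, s.val < t → b s = a s := by
  refine forall₂_congr fun s hs => ?_
  have hsu : s ≠ u := by
    rintro rfl
    exact absurd hs (not_lt.2 htu)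
  rw [Function.update_of_ne hsu]

/-- Makes the event of a large deviation in round `t` depend on earlier bits only, as `sum_gain_le`
demands. -/
theorem condMean_update {t u : Fin T} (htu : t ≤ u) (v : Bool) (a : Fin T → Bool) :
    condMean Q t (Function.update a u v) = condMean Q t a := by
  unfold condMean
  rw [prefixMass_succ_update, prefixMass_succ_update]
  unfold prefixMass
  simp only [forall_lt_update_iff htu]

/-- The denominators `r t` here and `1 - r t` in `ratioStep_false` cause the two regimes: a rare bit
moves the ratio far, a likely bit moves it often. -/
theorem ratioStep_true (hr : ∀ t, 0 < r t ∧ r t < 1) {t : Fin T} {a : Fin T → Bool}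
    (hQ : prefixMass Q t a ≠ 0) :
    ratioStep r Q t a true = prefixRatio r Q t a * (condMean Q t a - r t) / r t := by
  unfold ratioStep prefixRatio condMean
  rw [prefixProb_succ_update]
  have := (prefixProb_pos hr t a).ne'
  have := (hr t).1.ne'
  simp only [bitProb, if_true]
  field_simp

theorem ratioStep_false (hr : ∀ t, 0 < r t ∧ r t < 1) {t : Fin T} {a : Fin T → Bool}
    (hQ : prefixMass Q t a ≠ 0) :
    ratioStep r Q t a false = -(prefixRatio r Q t a * (condMean Q t a - r t) / (1 - r t)) := by
  have hm := sum_prefixMass_update (Q := Q) a t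
  rw [Fintype.sum_bool] at hm
  unfold ratioStep prefixRatio condMean
  rw [prefixProb_succ_update, eq_sub_iff_add_eq'.2 hm]
  have := (prefixProb_pos hr t a).ne'
  have : 1 - r t ≠ 0 := (sub_pos.2 (hr t).2).ne'
  simp only [bitProb, Bool.false_eq_true, if_false]
  field_simp
  ring

theorem prefixRatio_ge {s x : ℝ} (hs : s ≤ 1) (hx : |x - 1| ≤ s / 2) : 1 / 2 ≤ x := by
  have := (abs_le.mp hx).1
  linarith

theorem prefixMass_ne_zero {k : ℕ} {a : Fin T → Bool} (h : 1 / 2 ≤ prefixRatio r Q k a) :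
    prefixMass Q k a ≠ 0 := by
  intro h0
  rw [prefixRatio, h0, zero_div] at h
  norm_num at h

variable {γ η : ℝ} {δ : Fin T → ℝ}

/-- Dense regime: if in every round half of the mass has conditional mean at distance at least
`δ t` from `r t`, then the `δ t` are square summable with the rate of the total variation
distance. -/
theorem sum_sq_deviation_le_sq (hr : ∀ t, 0 < r t ∧ r t ≤ 3 / 4) (hη0 : 0 < η)
    (hη1 : η ≤ 1 / 128) (hη : ∑ a, |Q a - patternProb r a| ≤ η) (hδ : ∀ t, 0 ≤ δ t)
    (hmass : ∀ t, 1 / 2 ≤ ∑ a with δ t ≤ |condMean Q t a - r t|, Q a) :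
    ∑ t, δ t ^ 2 ≤ (128 * η) ^ 2 := by
  -- With this scale the bound `8 * s * η` on the total gain equals `s ^ 2 / 16`.
  set s := 128 * η with hs
  have hs0 : 0 < s := by positivity
  have hs1 : s ≤ 1 := by linarith
  have hr' : ∀ t, 0 < r t ∧ r t < 1 := fun t => ⟨(hr t).1, by linarith [(hr t).2]⟩
  have hg0 : ∀ t, 0 ≤ min (δ t ^ 2) (s * δ t) / 16 := fun t =>
    div_nonneg (le_min (sq_nonneg _) (mul_nonneg hs0.le (hδ t))) (by norm_num)
  have key := sum_gain_le (Q := Q) hr' hs0 hη (by linarith) (by linarith)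
    (fun t => min (δ t ^ 2) (s * δ t) / 16) hg0
    (fun t a => δ t ≤ |condMean Q t a - r t|)
    (fun t u v a htu => by rw [condMean_update htu]) hmass ?_
  -- A single `δ t > s` would already gain `s * δ t / 16`, more than the total. So every minimum is
  -- the quadratic one.
  · have hle : ∀ t, δ t ≤ s := by
      intro t
      by_contra! hlt
      have h1 := (Finset.single_le_sum (fun t _ => hg0 t) (Finset.mem_univ t)).trans key
      rw [min_eq_right (by nlinarith [hδ t])] at h1
      nlinarith
    have heq : ∀ t, min (δ t ^ 2) (s * δ t) / 16 = δ t ^ 2 / 16 := fun t => by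
      rw [min_eq_left (by nlinarith [hδ t, hle t])]
    simp only [heq, ← Finset.sum_div] at key
    nlinarith
  · intro t a hA hx
    have hf := prefixRatio_ge hs1 hx
    -- Bit `0` has probability at least `1/4`, and the ratio moves by at least `δ t / 2` because it
    -- is at least `1/2` and `1 - r t ≤ 1`.
    refine ⟨false, ?_⟩
    have hd : δ t / 2 ≤ |ratioStep r Q t a false| := by
      rw [ratioStep_false hr' (prefixMass_ne_zero hf), abs_neg, abs_div, abs_mul,
        abs_of_pos (show 0 < prefixRatio r Q t a by linarith),
        abs_of_pos (sub_pos.2 (hr' t).2), le_div_iff₀ (sub_pos.2 (hr' t).2)]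
      nlinarith [hδ t, (hr t).1]
    rw [← sq_abs (ratioStep r Q t a false)]
    set d := |ratioStep r Q t a false|
    have h1 : min (δ t ^ 2) (s * δ t) / 4 ≤ min (d ^ 2) (s * d / 2) := by
      refine le_min ?_ ?_
      · have := min_le_left (δ t ^ 2) (s * δ t)
        nlinarith [hδ t]
      · have := min_le_right (δ t ^ 2) (s * δ t)
        nlinarith [hδ t]
    have h2 : (1 : ℝ) / 4 ≤ bitProb (r t) false := by
      simp only [bitProb, Bool.false_eq_true, if_false]
      linarith [(hr t).2]
    have h3 := hg0 t
    nlinarith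

/-- Sparse regime: the same with the rate that comes from the rare ones. -/
theorem sum_sq_deviation_le_mul (hγ0 : 0 < γ) (hγ1 : γ ≤ 1)
    (hr : ∀ t, 0 < r t ∧ r t ≤ 3 / 4 * γ)
    (hη1 : η ≤ 1 / 128) (hη : ∑ a, |Q a - patternProb r a| ≤ η) (hδ : ∀ t, 0 ≤ δ t)
    (hδγ : ∀ t, δ t ≤ γ)
    (hmass : ∀ t, 1 / 2 ≤ ∑ a with δ t ≤ |condMean Q t a - r t|, Q a) :
    ∑ t, δ t ^ 2 ≤ 32 * η * γ := by
  have hr' : ∀ t, 0 < r t ∧ r t < 1 := fun t => ⟨(hr t).1, by linarith [(hr t).2]⟩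
  have key := sum_gain_le (Q := Q) hr' one_pos hη (by linarith) (by linarith)
    (fun t => δ t ^ 2 / (4 * γ)) (fun t => by positivity)
    (fun t a => δ t ≤ |condMean Q t a - r t|)
    (fun t u v a htu => by rw [condMean_update htu]) hmass ?_
  · rw [← Finset.sum_div, div_le_iff₀ (by positivity)] at key
    linarith
  · intro t a hA hx
    have hf := prefixRatio_ge le_rfl hx
    -- Bit `1` has probability only `r t`, but the ratio moves by at least `δ t / (2 * r t)`; the
    -- quadratic gain is then at least `δ t ^ 2 / (4 * r t)`. The linear one uses `δ t ≤ γ`.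
    refine ⟨true, ?_⟩
    have hrt := (hr' t).1
    have hd : δ t / (2 * r t) ≤ |ratioStep r Q t a true| := by
      rw [ratioStep_true hr' (prefixMass_ne_zero hf), abs_div, abs_mul,
        abs_of_pos (show 0 < prefixRatio r Q t a by linarith), abs_of_pos hrt,
        div_le_div_iff₀ (by positivity) hrt]
      have : δ t ≤ prefixRatio r Q t a * |condMean Q t a - r t| * 2 := by
        nlinarith [hδ t]
      nlinarith
    rw [← sq_abs (ratioStep r Q t a true)]
    set d := |ratioStep r Q t a true|
    have hdr : δ t / 2 ≤ r t * d := by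
      rw [div_le_iff₀ (by positivity)] at hd
      linarith
    have hd0 : 0 ≤ d := abs_nonneg _
    simp only [bitProb, if_true, one_mul]
    rw [mul_min_of_nonneg _ _ hrt.le]
    refine le_min ?_ ?_
    · rw [div_le_iff₀ (by positivity)]
      have h1 : δ t ^ 2 / 4 ≤ (r t * d) ^ 2 := by nlinarith [hδ t]
      have h2 : (r t * d) * (r t * d) ≤ γ * d * (r t * d) := by
        refine mul_le_mul_of_nonneg_right ?_ (by positivity)
        exact mul_le_mul_of_nonneg_right (by linarith [(hr t).2]) hd0
      nlinarith
    · rw [div_le_iff₀ (by positivity)]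
      nlinarith [hδ t, hδγ t, mul_nonneg (hδ t) (sub_nonneg.2 (hδγ t)),
        mul_le_mul_of_nonneg_right hdr hγ0.le]

end Deviation

/-! ### The weighted median -/

section Median

variable {ι : Type*} [Fintype ι] {w v : ι → ℝ}

/-- Sublevel weights change only at values of `v`, so the infimum is attained at one of them. If
more than half of the weight were strictly below it, the next smaller value would qualify too. -/
theorem weightedMedian_spec (hW : 0 < ∑ i, w i) :
    (∃ i, weightedMedian w v = v i) ∧
    (∑ i, w i) / 2 ≤ ∑ i with v i ≤ weightedMedian w v, w i ∧
    (∑ i, w i) / 2 ≤ ∑ i with weightedMedian w v ≤ v i, w i := by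
  classical
  set W := ∑ i, w i with hWdef
  set S : Set ℝ := {r : ℝ | W / 2 ≤ ∑ i with v i ≤ r, w i} with hS
  have reduce : ∀ U : Set ℝ, (0 < ∑ i with v i ∈ U, w i) →
      ∃ i, v i ∈ U ∧ ∀ k, v k ∈ U → v k ≤ v i := by
    intro U hU
    have hne : (Finset.univ.filter fun i => v i ∈ U).Nonempty := by
      by_contra h
      rw [Finset.not_nonempty_iff_eq_empty] at h
      simp [h] at hU
    obtain ⟨i, hi, hmax⟩ := Finset.exists_max_image _ v hne
    exact ⟨i, (Finset.mem_filter.1 hi).2, fun k hk => hmax k (by simpa using hk)⟩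
  have hbelow : ∀ r ∈ S, ∃ i, v i ≤ r ∧ v i ∈ S := by
    intro r hr
    have hpos : 0 < ∑ i with v i ∈ Set.Iic r, w i := by
      simp only [Set.mem_Iic]
      have : W / 2 ≤ ∑ i with v i ≤ r, w i := hr
      linarith
    obtain ⟨i, hi, hmax⟩ := reduce _ hpos
    refine ⟨i, hi, ?_⟩
    have heq : (Finset.univ.filter fun k => v k ≤ v i) = Finset.univ.filter fun k => v k ≤ r := by
      ext k
      simp only [Finset.mem_filter, Finset.mem_univ, true_and]
      exact ⟨fun h => h.trans hi, fun h => hmax k h⟩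
    change W / 2 ≤ ∑ k with v k ≤ v i, w k
    rw [heq]
    exact hr
  have hne : (Finset.univ.filter fun i => v i ∈ S).Nonempty := by
    have hι : (Finset.univ : Finset ι).Nonempty := by
      by_contra h
      rw [Finset.not_nonempty_iff_eq_empty] at h
      simp [hWdef, h] at hW
    obtain ⟨i, _, hmax⟩ := Finset.exists_max_image _ v hι
    refine ⟨i, ?_⟩
    simp only [Finset.mem_filter, Finset.mem_univ, true_and]
    change W / 2 ≤ ∑ k with v k ≤ v i, w k
    rw [Finset.filter_true_of_mem fun k _ => hmax k (Finset.mem_univ k)]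
    linarith
  obtain ⟨i, hi, hmin⟩ := Finset.exists_min_image _ v hne
  have hiS : v i ∈ S := (Finset.mem_filter.1 hi).2
  have hleast : IsLeast S (v i) := by
    refine ⟨hiS, fun r hr => ?_⟩
    obtain ⟨k, hk, hkS⟩ := hbelow r hr
    exact (hmin k (by simpa using hkS)).trans hk
  have hM : weightedMedian w v = v i := hleast.csInf_eq
  rw [hM]
  refine ⟨⟨i, rfl⟩, hiS, ?_⟩
  have hsplit : ∑ k with v i ≤ v k, w k = W - ∑ k with v k < v i, w k := by
    rw [hWdef, ← Finset.sum_filter_add_sum_filter_not Finset.univ (fun k => v i ≤ v k)]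
    simp only [not_le]
    ring
  rw [hsplit]
  by_contra! hlt
  have hlt' : W / 2 < ∑ k with v k < v i, w k := by linarith
  obtain ⟨k, hk, hmax⟩ := reduce (Set.Iio (v i))
    (by simp only [Set.mem_Iio]; linarith)
  have hkS : v k ∈ S := by
    change W / 2 ≤ ∑ l with v l ≤ v k, w l
    have heq : (Finset.univ.filter fun l => v l ≤ v k) = Finset.univ.filter fun l => v l < v i := by
      ext l
      simp only [Finset.mem_filter, Finset.mem_univ, true_and]
      exact ⟨fun h => h.trans_lt hk, fun h => hmax l h⟩
    rw [heq]
    exact hlt'.le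
  exact absurd (hleast.2 hkS) (not_le.2 hk)

end Median

/-! ### Empirical frequencies -/

section Empirical

variable {T n : ℕ}

/-- The frequency of the bit pattern `a` among the samples `y`. -/
noncomputable def patternFreq (y : Fin n → Fin T → Bool) (a : Fin T → Bool) : ℝ :=
  ((Finset.univ.filter fun j => y j = a).card : ℝ) / n

theorem sum_patternFreq_filter (y : Fin n → Fin T → Bool) (A : (Fin T → Bool) → Prop)
    [DecidablePred A] :
    ∑ a with A a, patternFreq y a = ((Finset.univ.filter fun j => A (y j)).card : ℝ) / n := by
  unfold patternFreq
  rw [← Finset.sum_div, ← Nat.cast_sum]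
  congr 2
  rw [Finset.card_eq_sum_card_fiberwise (f := y) (t := Finset.univ.filter A)
    (fun j hj => by simpa using hj)]
  refine Finset.sum_congr rfl fun a ha => ?_
  congr 1
  ext j
  simp only [Finset.mem_filter, Finset.mem_univ, true_and] at ha ⊢
  exact ⟨fun h => ⟨h ▸ ha, h⟩, fun h => h.2⟩

variable (y : Fin n → Fin T → Bool) (t : Fin T)

theorem sum_card_group_filter (C : ({s : Fin T // s < t} → Bool) → Prop) [DecidablePred C] :
    ∑ p with C p, ((group (fun j (s : {s : Fin T // s ≤ t}) => y j s.1) p).card : ℝ)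
      = ((Finset.univ.filter fun j => C fun s => y j s.1).card : ℝ) := by
  rw [← Nat.cast_sum]
  congr 1
  rw [Finset.card_eq_sum_card_fiberwise
    (f := fun j (s : {s : Fin T // s < t}) => y j s.1) (t := Finset.univ.filter C)
    (fun j hj => by simpa using hj)]
  refine Finset.sum_congr rfl fun p hp => ?_
  congr 1
  ext j
  simp only [group, Finset.mem_filter, Finset.mem_univ, true_and, ← funext_iff] at hp ⊢
  exact ⟨fun h => ⟨h ▸ hp, h⟩, fun h => h.2⟩

theorem prefixMass_patternFreq (a : Fin T → Bool) :
    prefixMass (patternFreq y) t a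
      = ((group (fun j (s : {s : Fin T // s ≤ t}) => y j s.1) fun s => a s.1).card : ℝ) / n := by
  unfold prefixMass
  rw [sum_patternFreq_filter]
  congr 3
  ext j
  simp [group]

theorem condMean_patternFreq (hn : n ≠ 0) (a : Fin T → Bool) :
    condMean (patternFreq y) t a
      = (((group (fun j (s : {s : Fin T // s ≤ t}) => y j s.1) fun s => a s.1).filter
          fun j => y j t = true).card : ℝ) /
        ((group (fun j (s : {s : Fin T // s ≤ t}) => y j s.1) fun s => a s.1).card : ℝ) := by
  unfold condMean
  rw [prefixMass_patternFreq, prefixMass_succ_update, sum_patternFreq_filter]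
  have hn' : (n : ℝ) ≠ 0 := Nat.cast_ne_zero.2 hn
  rw [div_div_div_cancel_right₀ hn']
  congr 3
  ext j
  simp [group]

variable {γ : ℝ}

/-- In every round, half of the samples lie in groups whose mean bit is at least as far from `p` as
the median of the capped group estimates. -/
theorem medianOfGroups_spec (hn : n ≠ 0) (hγ : 0 ≤ γ) {p : ℝ} (hp0 : 0 ≤ p) (hpγ : p ≤ γ) :
    |medianOfGroups γ (fun j (s : {s : Fin T // s ≤ t}) => y j s.1) - p| ≤ γ ∧
    1 / 2 ≤ ∑ a with |medianOfGroups γ (fun j (s : {s : Fin T // s ≤ t}) => y j s.1) - p|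
        ≤ |condMean (patternFreq y) t a - p|, patternFreq y a := by
  set y' := fun j (s : {s : Fin T // s ≤ t}) => y j s.1 with hy'
  have hn' : (0 : ℝ) < n := by positivity
  have hW : ∑ p, ((group y' p).card : ℝ) = n := by
    have := sum_card_group_filter y t (fun _ => True)
    simpa using this
  obtain ⟨⟨p₀, hp₀⟩, hle, hge⟩ := weightedMedian_spec (w := fun p => ((group y' p).card : ℝ))
    (v := groupEstimate γ y') (by rw [hW]; exact hn')
  change medianOfGroups γ y' = _ at hp₀
  change _ ≤ ∑ i with groupEstimate γ y' i ≤ medianOfGroups γ y', _ at hle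
  change _ ≤ ∑ i with medianOfGroups γ y' ≤ groupEstimate γ y' i, _ at hge
  rw [hW, sum_card_group_filter y t (fun i => groupEstimate γ y' i ≤ medianOfGroups γ y')] at hle
  rw [hW, sum_card_group_filter y t (fun i => medianOfGroups γ y' ≤ groupEstimate γ y' i)] at hge
  set M := medianOfGroups γ y' with hM
  have hM0 : 0 ≤ M := by
    rw [hp₀]
    exact le_min hγ (by positivity)
  have hM1 : M ≤ γ := by
    rw [hp₀]
    exact min_le_left _ _
  refine ⟨abs_le.2 ⟨by linarith, by linarith⟩, ?_⟩
  rw [sum_patternFreq_filter, le_div_iff₀ hn']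
  have hest : ∀ a : Fin T → Bool, groupEstimate γ y' (fun s => a s.1)
      = min γ (condMean (patternFreq y) t a) := fun a => by
    rw [condMean_patternFreq y t hn]
    rfl
  -- The cap does no harm on either side: an estimate at least `M` comes from a mean at least `M`,
  -- and an estimate at most `M < p ≤ γ` was not capped.
  rcases le_or_gt p M with h | h
  · have : (Finset.univ.filter fun j => M ≤ groupEstimate γ y' fun s => y j s.1).card ≤
        (Finset.univ.filter fun j => |M - p| ≤ |condMean (patternFreq y) t (y j) - p|).card := by
      refine Finset.card_le_card fun j hj => ?_
      simp only [Finset.mem_filter, Finset.mem_univ, true_and, hest] at hj ⊢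
      have := hj.trans (min_le_right _ _)
      rw [abs_of_nonneg (by linarith), abs_of_nonneg (by linarith)]
      linarith
    have : (_ : ℝ) ≤ _ := Nat.cast_le.2 this
    linarith
  · have : (Finset.univ.filter fun j => groupEstimate γ y' (fun s => y j s.1) ≤ M).card ≤
        (Finset.univ.filter fun j => |M - p| ≤ |condMean (patternFreq y) t (y j) - p|).card := by
      refine Finset.card_le_card fun j hj => ?_
      simp only [Finset.mem_filter, Finset.mem_univ, true_and, hest] at hj ⊢
      have := (min_le_iff.1 hj).resolve_left (by linarith)
      rw [abs_of_nonpos (by linarith), abs_of_nonpos (by linarith)]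
      linarith
    have : (_ : ℝ) ≤ _ := Nat.cast_le.2 this
    linarith

/-- The deterministic guarantee of the median of groups. -/
theorem sum_sq_medianOfGroups_le (hn : n ≠ 0) (hγ0 : 0 < γ) (hγ1 : γ ≤ 1) {r : Fin T → ℝ}
    (hr : ∀ t, 0 < r t ∧ r t ≤ 3 / 4 * γ) {η : ℝ} (hη0 : 0 < η) (hη1 : η ≤ 1 / 128)
    (hη : ∑ a, |patternFreq y a - patternProb r a| ≤ η) :
    ∑ t, (medianOfGroups γ (fun j (s : {s : Fin T // s ≤ t}) => y j s.1) - r t) ^ 2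
        ≤ (128 * η) ^ 2 ∧
    ∑ t, (medianOfGroups γ (fun j (s : {s : Fin T // s ≤ t}) => y j s.1) - r t) ^ 2
        ≤ 32 * η * γ := by
  have hspec := fun t => medianOfGroups_spec y t hn hγ0.le (hr t).1.le
    (show r t ≤ γ by linarith [(hr t).2])
  simp only [← sq_abs (medianOfGroups γ _ - r _)]
  exact ⟨sum_sq_deviation_le_sq (fun t => ⟨(hr t).1, by linarith [(hr t).2]⟩) hη0 hη1 hη
      (fun t => abs_nonneg _) fun t => (hspec t).2,
    sum_sq_deviation_le_mul hγ0 hγ1 hr hη1 hη (fun t => abs_nonneg _)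
      (fun t => (hspec t).1) fun t => (hspec t).2⟩

end Empirical

/-! ### Concentration of empirical frequencies -/

section Concentration

variable {α : Type*} [Fintype α]

/-- Positive and negative parts of `p - q` have equal mass, so the ℓ¹ distance is twice the excess
on the set where `p ≥ q`. -/
theorem sum_abs_sub_le {p q : α → ℝ} (hpq : ∑ a, p a = ∑ a, q a) {ε : ℝ}
    (h : ∀ S : Finset α, ∑ a ∈ S, (p a - q a) ≤ ε) : ∑ a, |p a - q a| ≤ 2 * ε := by
  have h0 : ∑ a, (p a - q a) = 0 := by rw [Finset.sum_sub_distrib, hpq, sub_self]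
  have h1 := h (Finset.univ.filter fun a => 0 ≤ p a - q a)
  rw [← Finset.sum_filter_add_sum_filter_not Finset.univ (fun a => 0 ≤ p a - q a)] at h0 ⊢
  have h2 : ∑ a with 0 ≤ p a - q a, |p a - q a| = ∑ a with 0 ≤ p a - q a, (p a - q a) :=
    Finset.sum_congr rfl fun a ha => abs_of_nonneg (Finset.mem_filter.1 ha).2
  have h3 : ∑ a with ¬ 0 ≤ p a - q a, |p a - q a| = -∑ a with ¬ 0 ≤ p a - q a, (p a - q a) := by
    rw [← Finset.sum_neg_distrib]
    exact Finset.sum_congr rfl fun a ha =>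
      abs_of_neg (not_le.1 (Finset.mem_filter.1 ha).2)
  linarith

variable [DecidableEq α] [MeasurableSpace α] [DiscreteMeasurableSpace α] (ν : Measure α) [IsProbabilityMeasure ν]

/-- Hoeffding's inequality for the empirical measure of one set. -/
theorem measureReal_count_ge_le (n : ℕ) (S : Finset α) {ε : ℝ} (hε : 0 < ε) :
    (Measure.pi fun _ : Fin n => ν).real
        {z | n * ε ≤ ∑ j, ((if z j ∈ S then 1 else 0) - ν.real S)}
      ≤ Real.exp (-(2 * n * ε ^ 2)) := by
  set X : Fin n → (Fin n → α) → ℝ := fun j z => (if z j ∈ S then 1 else 0) - ν.real S with hX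
  have hind : iIndepFun X (Measure.pi fun _ : Fin n => ν) :=
    iIndepFun_pi (X := fun (_ : Fin n) (a : α) => (if a ∈ S then (1 : ℝ) else 0) - ν.real S)
      fun j => (measurable_of_countable _).aemeasurable
  have hm : ∀ j : Fin n, Measurable fun z : Fin n → α => if z j ∈ S then (1 : ℝ) else 0 :=
    fun j => (measurable_of_countable fun a : α => if a ∈ S then (1 : ℝ) else 0).comp
      (measurable_pi_apply j)
  have hint : ∀ j : Fin n, ∫ z, (if z j ∈ S then (1 : ℝ) else 0) ∂(Measure.pi fun _ : Fin n => ν)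
      = ν.real S := by
    intro j
    have h1 := (measurePreserving_eval (fun _ : Fin n => ν) j).map_eq
    have h2 := integral_map (μ := Measure.pi fun _ : Fin n => ν)
      (φ := fun z : Fin n → α => z j) (measurable_pi_apply j).aemeasurable
      (f := fun a : α => if a ∈ S then (1 : ℝ) else 0)
      (measurable_of_countable _).aestronglyMeasurable
    rw [← h2]
    rw [show (fun z : Fin n → α => z j) = Function.eval j from rfl, h1]
    have : (fun a : α => if a ∈ S then (1 : ℝ) else 0) = (S : Set α).indicator 1 := by
      ext a; simp [Set.indicator_apply]
    rw [this, integral_indicator_one (Set.toFinite _).measurableSet]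
  have hsub : ∀ j ∈ Finset.univ, HasSubgaussianMGF (X j) ((‖(1 : ℝ) - 0‖₊ / 2) ^ 2)
      (Measure.pi fun _ : Fin n => ν) := by
    intro j _
    have := hasSubgaussianMGF_of_mem_Icc (μ := Measure.pi fun _ : Fin n => ν) (a := 0) (b := 1)
      (hm j).aemeasurable (ae_of_all _ fun z => by split_ifs <;> simp)
    rwa [hint j] at this
  have := HasSubgaussianMGF.measure_sum_ge_le_of_iIndepFun hind hsub
    (ε := n * ε) (by positivity)
  refine this.trans (Real.exp_le_exp.2 ?_)
  rcases Nat.eq_zero_or_pos n with rfl | hn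
  · simp
  · have hn' : (0 : ℝ) < n := by exact_mod_cast hn
    apply le_of_eq
    simp
    field_simp

/-- The empirical measure of `n` samples converges in total variation. -/
theorem measureReal_freq_le (n : ℕ) (hn : n ≠ 0) {ε : ℝ} (hε : 0 < ε) :
    (Measure.pi fun _ : Fin n => ν).real {z | 2 * ε <
        ∑ a, |((Finset.univ.filter fun j => z j = a).card : ℝ) / n - ν.real {a}|}
      ≤ 2 ^ Fintype.card α * Real.exp (-(2 * n * ε ^ 2)) := by
  have hn' : (0 : ℝ) < n := by positivity
  have hsub : {z : Fin n → α | 2 * ε <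
        ∑ a, |((Finset.univ.filter fun j => z j = a).card : ℝ) / n - ν.real {a}|}
      ⊆ ⋃ S : Finset α, {z | n * ε ≤ ∑ j, ((if z j ∈ S then 1 else 0) - ν.real S)} := by
    intro z hz
    by_contra hcon
    simp only [Set.mem_iUnion, Set.mem_ofPred_eq, not_exists, not_le] at hcon hz
    refine absurd hz (not_lt.2 (sum_abs_sub_le ?_ fun S => ?_))
    · have h1 : ∑ a, ν.real {a} = 1 := by
        rw [sum_measureReal_singleton, Finset.coe_univ, probReal_univ]
      rw [h1, ← Finset.sum_div, ← Nat.cast_sum,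
        ← Finset.card_eq_sum_card_fiberwise (f := z) (fun j _ => by simp)]
      simp [hn]
    · have h1 := hcon S
      rw [Finset.sum_sub_distrib] at h1 ⊢
      rw [sum_measureReal_singleton, ← Finset.sum_div, ← Nat.cast_sum]
      have h2 : ∑ a ∈ S, (Finset.univ.filter fun j => z j = a).card
          = (Finset.univ.filter fun j => z j ∈ S).card := by
        rw [Finset.card_eq_sum_card_fiberwise (f := z) (t := S) (fun j hj => by simpa using hj)]
        refine Finset.sum_congr rfl fun a ha => ?_
        congr 1
        ext j
        simp only [Finset.mem_filter, Finset.mem_univ, true_and]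
        exact ⟨fun h => ⟨h ▸ ha, h⟩, fun h => h.2⟩
      rw [h2]
      simp only [Finset.sum_boole, Finset.sum_const, Finset.card_univ, Fintype.card_fin,
        nsmul_eq_mul] at h1
      rw [sub_le_iff_le_add, div_le_iff₀ hn']
      nlinarith
  refine (measureReal_mono hsub).trans ((measureReal_iUnion_fintype_le _).trans ?_)
  refine (Finset.sum_le_sum fun S _ => measureReal_count_ge_le ν n S hε).trans ?_
  simp

end Concentration

/-! ### The law of the noisy bits -/

section Law

variable {T n : ℕ}

theorem measurable_addNoise (γ : ℝ) :
    Measurable fun z : Bool × unitInterval => addNoise γ z.2 z.1 := by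
  unfold addNoise
  refine Measurable.ite ?_ measurable_const (Measurable.ite ?_ measurable_const measurable_fst)
  · exact measurableSet_le (measurable_subtype_coe.comp measurable_snd) measurable_const
  · exact measurableSet_le (measurable_subtype_coe.comp measurable_snd) measurable_const

/-- The law of a noisy bit, where the clean bit is a function of a real random variable. -/
noncomputable def noisyBitLaw (γ : ℝ) (φ : ℝ → Bool) (ρ : Measure ℝ) : Measure Bool :=
  (ρ.prod (volume : Measure unitInterval)).map fun z => addNoise γ z.2 (φ z.1)

/-- All samples, bit by bit, with noise. -/
noncomputable def noisyBits (γ : ℝ) (φ : ℝ → Bool)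
    (z : (Fin n → Fin T → ℝ) × (Fin n → Fin T → unitInterval)) (j : Fin n) (t : Fin T) : Bool :=
  addNoise γ (z.2 j t) (φ (z.1 j t))

theorem measurePreserving_noisyBits {P : Measure (Fin T → ℝ)} [IsProbabilityMeasure P]
    (hP : iIndepFun (fun (t : Fin T) (x : Fin T → ℝ) => x t) P) (γ : ℝ) {φ : ℝ → Bool}
    (hφ : Measurable φ) :
    MeasurePreserving (noisyBits γ φ)
      ((Measure.pi fun _ : Fin n => P).prod
        (volume : Measure (Fin n → Fin T → unitInterval)))
      (Measure.pi fun _ : Fin n => Measure.pi fun t =>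
        noisyBitLaw γ φ (P.map fun x => x t)) := by
  have hPt : ∀ t : Fin T, IsProbabilityMeasure (P.map fun x => x t) := fun t =>
    Measure.isProbabilityMeasure_map (measurable_pi_apply t).aemeasurable
  -- Independence makes `P` the product of its marginals, so samples and noise can be regrouped into
  -- independent pairs, one for each sample and round.
  have hPpi : P = Measure.pi fun t => P.map fun x : Fin T → ℝ => x t := by
    have := (iIndepFun_iff_map_fun_eq_pi_map
      (fun t => (measurable_pi_apply t).aemeasurable)).1 hP
    rwa [show (fun (ω : Fin T → ℝ) (i : Fin T) => ω i) = id from rfl, Measure.map_id] at this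
  have hmeas : Measurable fun z : ℝ × unitInterval => addNoise γ z.2 (φ z.1) :=
    (measurable_addNoise γ).comp ((hφ.comp measurable_fst).prodMk measurable_snd)
  have hB : ∀ t, IsProbabilityMeasure (noisyBitLaw γ φ (P.map fun x : Fin T → ℝ => x t)) :=
    fun t => Measure.isProbabilityMeasure_map hmeas.aemeasurable
  have inner : MeasurePreserving
      (fun (z : (Fin T → ℝ) × (Fin T → unitInterval)) t => addNoise γ (z.2 t) (φ (z.1 t)))
      (P.prod volume) (Measure.pi fun t => noisyBitLaw γ φ (P.map fun x => x t)) := by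
    have h1 := (measurePreserving_arrowProdEquivProdArrow ℝ unitInterval (Fin T)
      (fun t => P.map fun x : Fin T → ℝ => x t) (fun _ => volume)).symm
    rw [← hPpi] at h1
    have h2 := measurePreserving_pi
      (fun t => (P.map fun x : Fin T → ℝ => x t).prod (volume : Measure unitInterval))
      (fun t => noisyBitLaw γ φ (P.map fun x => x t))
      (f := fun _ z => addNoise γ z.2 (φ z.1)) (fun t => ⟨hmeas, rfl⟩)
    exact h2.comp h1
  have h1 := (measurePreserving_arrowProdEquivProdArrow (Fin T → ℝ) (Fin T → unitInterval) (Fin n)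
      (fun _ => P) (fun _ => volume)).symm
  have h2 := measurePreserving_pi (fun _ : Fin n => P.prod volume)
      (fun _ => Measure.pi fun t => noisyBitLaw γ φ (P.map fun x => x t))
      (fun _ => inner)
  exact h2.comp h1

theorem noisyBitLaw_true {γ : ℝ} (hγ0 : 0 ≤ γ) (hγ1 : γ ≤ 1) {φ : ℝ → Bool} (hφ : Measurable φ)
    (ρ : Measure ℝ) [IsProbabilityMeasure ρ] :
    (noisyBitLaw γ φ ρ).real {true} = γ / 4 + ρ.real {x | φ x = true} / 2 := by
  have hmeas : Measurable fun z : ℝ × unitInterval => addNoise γ z.2 (φ z.1) :=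
    (measurable_addNoise γ).comp ((hφ.comp measurable_fst).prodMk measurable_snd)
  set a : unitInterval := ⟨γ / 4, by constructor <;> linarith⟩ with ha
  set b : unitInterval := ⟨1 / 2, by norm_num, by norm_num⟩ with hb
  have hset : (fun z : ℝ × unitInterval => addNoise γ z.2 (φ z.1)) ⁻¹' {true}
      = Set.univ ×ˢ Set.Iic a ∪ {x | φ x = true} ×ˢ Set.Ioi b := by
    ext ⟨x, u⟩
    have h1 : (u : ℝ) ≤ γ / 4 ↔ u ≤ a := Iff.rfl
    have h2 : (u : ℝ) ≤ 1 / 2 ↔ u ≤ b := Iff.rfl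
    simp only [Set.mem_preimage, addNoise, h1, h2, Set.mem_singleton_iff, Set.mem_union,
      Set.mem_prod, Set.mem_univ, true_and, Set.mem_Iic, Set.mem_Ioi, Set.mem_ofPred_eq]
    have hab : a ≤ b := by
      change γ / 4 ≤ 1 / 2
      linarith
    by_cases hua : u ≤ a
    · simp [hua]
    · by_cases hub : u ≤ b
      · simp [hua, hub, not_lt.2 hub]
      · simp [hua, hub, not_le.1 hub]
  have hdisj : Disjoint ((Set.univ : Set ℝ) ×ˢ Set.Iic a) ({x | φ x = true} ×ˢ Set.Ioi b) := by
    refine Set.disjoint_left.2 fun z hz hz' => ?_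
    have h1 : (z.2 : ℝ) ≤ γ / 4 := hz.2
    have h2 : 1 / 2 < (z.2 : ℝ) := hz'.2
    linarith
  have hms : MeasurableSet {x | φ x = true} := hφ (measurableSet_singleton true)
  rw [noisyBitLaw, map_measureReal_apply hmeas (measurableSet_singleton _), hset,
    measureReal_union hdisj (hms.prod measurableSet_Ioi), measureReal_prod_prod,
    measureReal_prod_prod, probReal_univ, measureReal_def volume, measureReal_def volume,
    unitInterval.volume_Iic, unitInterval.volume_Ioi,
    ENNReal.toReal_ofReal (by simp [ha]; positivity), ENNReal.toReal_ofReal (by simp [hb]; norm_num)]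
  simp only [ha, hb]
  ring

theorem noisyPatternLaw_singleton {γ : ℝ} (hγ0 : 0 ≤ γ) (hγ1 : γ ≤ 1) {φ : ℝ → Bool}
    (hφ : Measurable φ) (ρ : Fin T → Measure ℝ) [∀ t, IsProbabilityMeasure (ρ t)]
    (a : Fin T → Bool) :
    (Measure.pi fun t => noisyBitLaw γ φ (ρ t)).real {a}
      = patternProb (fun t => γ / 4 + (ρ t).real {x | φ x = true} / 2) a := by
  have hmeas : Measurable fun z : ℝ × unitInterval => addNoise γ z.2 (φ z.1) :=
    (measurable_addNoise γ).comp ((hφ.comp measurable_fst).prodMk measurable_snd)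
  have hB : ∀ t, IsProbabilityMeasure (noisyBitLaw γ φ (ρ t)) :=
    fun t => Measure.isProbabilityMeasure_map hmeas.aemeasurable
  rw [measureReal_def, Measure.pi_singleton, ENNReal.toReal_prod]
  refine Finset.prod_congr rfl fun t _ => ?_
  change (noisyBitLaw γ φ (ρ t)).real {a t} = _
  have htrue := noisyBitLaw_true hγ0 hγ1 hφ (ρ t)
  cases hat : a t
  · have h1 : ({false} : Set Bool) = {true}ᶜ := by ext v; cases v <;> simp
    rw [h1, probReal_compl_eq_one_sub (measurableSet_singleton _), htrue]
    simp [bitProb]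
  · rw [htrue]
    simp [bitProb]

end Law

/-! ### The guarantee of binary product estimation -/

section Binary

variable {T n : ℕ}

theorem sum_abs_patternFreq_sub_le (y y' : Fin n → Fin T → Bool) (hn : n ≠ 0) {ε : ℝ}
    (h : (Set.ncard {j | y j ≠ y' j} : ℝ) ≤ ε * n) :
    ∑ a, |patternFreq y a - patternFreq y' a| ≤ 2 * ε := by
  classical
  have hn' : (0 : ℝ) < n := by positivity
  have h1 : ∀ a, |patternFreq y a - patternFreq y' a|
      ≤ (∑ j, |(if y j = a then (1 : ℝ) else 0) - if y' j = a then 1 else 0|) / n := by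
    intro a
    unfold patternFreq
    rw [← sub_div, abs_div, abs_of_pos hn']
    gcongr
    rw [Finset.natCast_card_filter, Finset.natCast_card_filter, ← Finset.sum_sub_distrib]
    exact Finset.abs_sum_le_sum_abs _ _
  refine (Finset.sum_le_sum fun a _ => h1 a).trans ?_
  rw [← Finset.sum_div, Finset.sum_comm, div_le_iff₀ hn']
  have h2 : ∀ j, ∑ a, |(if y j = a then (1 : ℝ) else 0) - if y' j = a then 1 else 0|
      ≤ if y j ≠ y' j then 2 else 0 := by
    intro j
    split_ifs with hj
    · calc _ ≤ ∑ a, ((if y j = a then (1 : ℝ) else 0) + if y' j = a then 1 else 0) :=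
            Finset.sum_le_sum fun a _ => by split_ifs <;> norm_num
        _ = 2 := by simp [Finset.sum_add_distrib]; norm_num
    · rw [not_not] at hj
      simp [hj]
  refine (Finset.sum_le_sum fun j _ => h2 j).trans ?_
  rw [← Finset.sum_filter, Finset.sum_const, nsmul_eq_mul]
  rw [Set.ncard_eq_toFinset_card', Set.toFinset_ofPred] at h
  linarith

/-- Binary product estimation is accurate if the clean noisy bits are typical. -/
theorem sqrt_sum_sq_binaryProductEstimation_le (hn : n ≠ 0) {γ ε : ℝ} (hγ0 : 0 < γ) (hγ1 : γ ≤ 1)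
    (hε0 : 0 < ε) (hε1 : ε ≤ 1 / 512) {p : Fin T → ℝ} (hp : ∀ t, 0 ≤ p t ∧ p t ≤ γ)
    (u : Fin n → Fin T → unitInterval) (b b' : Fin n → Fin T → Bool)
    (hb : (Set.ncard {j | b' j ≠ b j} : ℝ) ≤ ε * n)
    (htyp : ∑ a, |patternFreq (fun j t => addNoise γ (u j t) (b j t)) a
      - patternProb (fun t => γ / 4 + p t / 2) a| ≤ 2 * ε) :
    √(∑ t, (binaryProductEstimation γ u (fun j (s : {s : Fin T // s ≤ t}) => b' j s.1) - p t) ^ 2)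
      ≤ 1024 * min ε √(ε * γ) := by
  set r : Fin T → ℝ := fun t => γ / 4 + p t / 2
  set y := fun j t => addNoise γ (u j t) (b j t)
  set y' := fun j t => addNoise γ (u j t) (b' j t) with hy'
  have hcor : (Set.ncard {j | y' j ≠ y j} : ℝ) ≤ ε * n := by
    -- Clean and corrupted samples share the noise `u`, so noise creates no new disagreement.
    have hsub : {j | y' j ≠ y j} ⊆ {j | b' j ≠ b j} := by
      intro j hj hbj
      refine hj ?_
      funext t
      simp only [y, y', hbj]
    have hcard := Set.ncard_le_ncard hsub (Set.toFinite _)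
    have hcard' : (Set.ncard {j | y' j ≠ y j} : ℝ) ≤ Set.ncard {j | b' j ≠ b j} := by
      exact_mod_cast hcard
    exact hcard'.trans hb
  have hη : ∑ a, |patternFreq y' a - patternProb r a| ≤ 4 * ε := by
    have h1 := sum_abs_patternFreq_sub_le y' y hn hcor
    calc _ ≤ ∑ a, (|patternFreq y' a - patternFreq y a| + |patternFreq y a - patternProb r a|) :=
          Finset.sum_le_sum fun a _ => abs_sub_le _ _ _
      _ ≤ 4 * ε := by rw [Finset.sum_add_distrib]; linarith
  obtain ⟨h1, h2⟩ := sum_sq_medianOfGroups_le y' hn hγ0 hγ1 (r := r)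
    (fun t => ⟨by have := hp t; simp only [r]; linarith, by have := hp t; simp only [r]; linarith⟩)
    (η := 4 * ε) (by positivity) (by linarith) hη
  have heq : ∀ t, (binaryProductEstimation γ u
      (fun j (s : {s : Fin T // s ≤ t}) => b' j s.1) - p t) ^ 2
      = 4 * (medianOfGroups γ (fun j (s : {s : Fin T // s ≤ t}) => y' j s.1) - r t) ^ 2 := by
    intro t
    simp only [binaryProductEstimation, y', r]
    ring
  simp only [heq, ← Finset.mul_sum]
  rw [mul_min_of_nonneg _ _ (by norm_num)]
  -- With `η = 4 * ε` and the factor `4` from undoing the affine map, the bounds are `4 * (512 * ε)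
  -- ^ 2 = (1024 * ε) ^ 2` and `512 * ε * γ`.
  refine le_min (Real.sqrt_le_iff.2 ⟨by positivity, by nlinarith⟩)
    (Real.sqrt_le_iff.2 ⟨by positivity, ?_⟩)
  rw [mul_pow, Real.sq_sqrt (by positivity)]
  have : 0 ≤ ε * γ := by positivity
  nlinarith

end Binary

/-! ### Riemann sums of antitone functions -/

section Riemann

variable {g : ℝ → ℝ}

theorem riemann_sum_le_integral (hg : AntitoneOn g (Set.Ioi 0))
    (hint : IntegrableOn g (Set.Ioi 0)) {h : ℝ} (hh : 0 < h) (m : ℕ) :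
    ∑ i ∈ Finset.range m, g ((i + 1) * h) * h ≤ ∫ q in Set.Ioc 0 (m * h), g q := by
  induction m with
  | zero => simp
  | succ m ih =>
    have h1 : (m : ℝ) * h ≤ (m + 1 : ℝ) * h := by nlinarith
    have h0 : 0 ≤ (m : ℝ) * h := by positivity
    have hi2 : IntegrableOn g (Set.Ioc (m * h) ((m + 1 : ℝ) * h)) :=
      hint.mono_set fun q hq => lt_of_le_of_lt h0 hq.1
    rw [Finset.sum_range_succ, Nat.cast_succ, ← Set.Ioc_union_Ioc_eq_Ioc h0 h1,
      setIntegral_union (Set.Ioc_disjoint_Ioc_of_le le_rfl) measurableSet_Ioc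
        (hint.mono_set fun q hq => hq.1) hi2]
    refine add_le_add ih ?_
    calc g ((m + 1) * h) * h = ∫ _ in Set.Ioc (m * h) ((m + 1 : ℝ) * h), g ((m + 1) * h) := by
          rw [setIntegral_const, Real.volume_real_Ioc_of_le h1, smul_eq_mul]
          ring
      _ ≤ _ := setIntegral_mono_on (by simp) hi2 measurableSet_Ioc fun q hq =>
          hg (lt_of_le_of_lt h0 hq.1) (by simp only [Set.mem_Ioi]; positivity) hq.2

/-- The sum has `m` terms but the integral covers `m + 1` cells: each term bounds the cell to its
right, and the extra `h` pays for the first cell, where `g ≤ 1`. -/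
theorem integral_le_riemann_sum (hg : AntitoneOn g (Set.Ioi 0)) (hg1 : ∀ q, 0 < q → g q ≤ 1)
    (hint : IntegrableOn g (Set.Ioi 0)) {h : ℝ} (hh : 0 < h) (m : ℕ) :
    ∫ q in Set.Ioc 0 ((m + 1) * h), g q ≤ ∑ i ∈ Finset.range m, g ((i + 1) * h) * h + h := by
  induction m with
  | zero =>
    calc ∫ q in Set.Ioc 0 (((0 : ℕ) + 1) * h), g q ≤ ∫ _ in Set.Ioc 0 (((0 : ℕ) + 1) * h), 1 :=
          setIntegral_mono_on (hint.mono_set fun q hq => hq.1) (by simp) measurableSet_Ioc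
            fun q hq => hg1 q hq.1
      _ = _ := by
        rw [setIntegral_const, Real.volume_real_Ioc_of_le (by positivity)]
        simp
  | succ m ih =>
    have h1 : (m + 1 : ℝ) * h ≤ (m + 1 + 1 : ℝ) * h := by nlinarith
    have h0 : 0 < (m + 1 : ℝ) * h := by positivity
    have hi2 : IntegrableOn g (Set.Ioc ((m + 1 : ℝ) * h) ((m + 1 + 1 : ℝ) * h)) :=
      hint.mono_set fun q hq => h0.trans hq.1
    rw [Finset.sum_range_succ, Nat.cast_succ, ← Set.Ioc_union_Ioc_eq_Ioc h0.le h1,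
      setIntegral_union (Set.Ioc_disjoint_Ioc_of_le le_rfl) measurableSet_Ioc
        (hint.mono_set fun q hq => hq.1) hi2]
    have : ∫ q in Set.Ioc ((m + 1 : ℝ) * h) ((m + 1 + 1 : ℝ) * h), g q ≤ g ((m + 1) * h) * h :=
      calc _ ≤ ∫ _ in Set.Ioc ((m + 1 : ℝ) * h) ((m + 1 + 1 : ℝ) * h), g ((m + 1) * h) :=
            setIntegral_mono_on hi2 (by simp) measurableSet_Ioc fun q hq =>
              hg h0 (h0.trans hq.1) hq.1.le
        _ = _ := by
          rw [setIntegral_const, Real.volume_real_Ioc_of_le h1, smul_eq_mul]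
          ring
    linarith

theorem integral_Ioc_le {a b : ℝ} (ha : 0 ≤ a) (hab : a ≤ b) (hg1 : ∀ q, 0 < q → g q ≤ 1)
    (hint : IntegrableOn g (Set.Ioi 0)) : ∫ q in Set.Ioc a b, g q ≤ b - a :=
  calc _ ≤ ∫ _ in Set.Ioc a b, (1 : ℝ) :=
        setIntegral_mono_on (hint.mono_set fun q hq => lt_of_le_of_lt ha hq.1) (by simp)
          measurableSet_Ioc fun q hq => hg1 q (lt_of_le_of_lt ha hq.1)
    _ = b - a := by
      rw [setIntegral_const, Real.volume_real_Ioc_of_le hab]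
      simp

theorem integral_Ioi_eq_add {a b : ℝ} (ha : 0 ≤ a) (hab : a ≤ b)
    (hint : IntegrableOn g (Set.Ioi 0)) :
    ∫ q in Set.Ioi a, g q = (∫ q in Set.Ioc a b, g q) + ∫ q in Set.Ioi b, g q := by
  rw [← Set.Ioc_union_Ioi_eq_Ioi hab]
  exact setIntegral_union (Set.Ioc_disjoint_Ioi le_rfl) measurableSet_Ioi
    (hint.mono_set fun q hq => lt_of_le_of_lt ha hq.1)
    (hint.mono_set fun q hq => lt_of_le_of_lt (ha.trans hab) hq)

end Riemann

/-! ### The truncation level -/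

/-- The standing assumptions on the tail bound `F`. -/
structure IsTailBound (F : ℝ → ℝ) (ε : ℝ) : Prop where
  anti : AntitoneOn F (Set.Ioi 0)
  mem : ∀ q : ℝ, 0 < q → 0 ≤ F q ∧ F q ≤ 1
  integrable_min : IntegrableOn (fun q : ℝ => min ε (√(ε * F q))) (Set.Ioi 0)

namespace IsTailBound

variable {F : ℝ → ℝ} {ε : ℝ} {T : ℕ}

/-- Since `ε * F q ≤ 1`, it is below its own square root. Hence convergence of `Q_{F,ε}` makes `F`
integrable, and `Q_{F,ε} = 0` forces `L = 0`. -/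
theorem mul_le_min (hF : IsTailBound F ε) (hε0 : 0 < ε) (hε1 : ε ≤ 1) {q : ℝ} (hq : 0 < q) :
    ε * F q ≤ min ε (√(ε * F q)) := by
  obtain ⟨h0, h1⟩ := hF.mem q hq
  have h2 : 0 ≤ ε * F q := by positivity
  refine le_min (by nlinarith) (Real.le_sqrt_of_sq_le ?_)
  nlinarith [mul_le_one₀ hε1 h0 h1]

theorem integrableOn (hF : IsTailBound F ε) (hε0 : 0 < ε) (hε1 : ε ≤ 1) :
    IntegrableOn F (Set.Ioi 0) := by
  refine Integrable.mono' (hF.integrable_min.const_mul ε⁻¹)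
    (aemeasurable_restrict_of_antitoneOn measurableSet_Ioi hF.anti).aestronglyMeasurable
    ((ae_restrict_mem measurableSet_Ioi).mono fun q hq => ?_)
  rw [Real.norm_of_nonneg (hF.mem q hq).1, le_inv_mul_iff₀ hε0]
  exact hF.mul_le_min hε0 hε1 hq

theorem antitoneOn_min (hF : IsTailBound F ε) (hε0 : 0 < ε) :
    AntitoneOn (fun q : ℝ => min ε (√(ε * F q))) (Set.Ioi 0) := fun _ ha _ hb hab =>
  min_le_min le_rfl (Real.sqrt_le_sqrt (mul_le_mul_of_nonneg_left (hF.anti ha hb hab) hε0.le))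

theorem tailQ_nonneg (hε0 : 0 < ε) : 0 ≤ tailQ F ε :=
  setIntegral_nonneg measurableSet_Ioi fun _ _ => le_min hε0.le (Real.sqrt_nonneg _)

theorem integral_le_tailQ_div (hF : IsTailBound F ε) (hε0 : 0 < ε) (hε1 : ε ≤ 1) :
    ∫ q in Set.Ioi 0, F q ≤ tailQ F ε / ε := by
  rw [le_div_iff₀ hε0, mul_comm, ← integral_const_mul]
  exact setIntegral_mono_on ((hF.integrableOn hε0 hε1).const_mul ε) hF.integrable_min
    measurableSet_Ioi fun q hq => hF.mul_le_min hε0 hε1 hq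

theorem tailL_nonneg : 0 ≤ tailL F ε T := Real.sInf_nonneg fun _ hz => hz.1

theorem tailL_le {z : ℝ} (hz : 0 ≤ z) (h : ∫ q in Set.Ioi z, F q ≤ tailQ F ε / √T) :
    tailL F ε T ≤ z :=
  csInf_le ⟨0, fun _ hz => hz.1⟩ ⟨hz, h⟩

theorem tailQ_pos (hF : IsTailBound F ε) (hε0 : 0 < ε) (hε1 : ε ≤ 1) (hL : 0 < tailL F ε T) :
    0 < tailQ F ε := by
  refine lt_of_le_of_ne (tailQ_nonneg hε0) fun h0 => absurd hL (not_lt.2 (tailL_le le_rfl ?_))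
  have := hF.integral_le_tailQ_div hε0 hε1
  rw [← h0, zero_div] at this ⊢
  exact this

theorem exists_integral_le (hF : IsTailBound F ε) (hε0 : 0 < ε) (hε1 : ε ≤ 1) (hT : 1 ≤ T) :
    ∃ z, 0 ≤ z ∧ ∫ q in Set.Ioi z, F q ≤ tailQ F ε / √T := by
  have hint := hF.integrableOn hε0 hε1
  rcases (tailQ_nonneg (F := F) hε0).eq_or_lt with h0 | hpos
  · refine ⟨0, le_rfl, ?_⟩
    have := hF.integral_le_tailQ_div hε0 hε1
    rw [← h0, zero_div] at this ⊢
    exact this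
  · have hlim := intervalIntegral_tendsto_integral_Ioi 0 hint Filter.tendsto_id
    have hT' : (0 : ℝ) < √T := Real.sqrt_pos.2 (by exact_mod_cast hT)
    have hev := hlim.eventually_const_lt
      (show (∫ q in Set.Ioi 0, F q) - tailQ F ε / √T < ∫ q in Set.Ioi 0, F q by
        have : 0 < tailQ F ε / √T := by positivity
        linarith)
    obtain ⟨z, hz, hz0⟩ := (hev.and (Filter.eventually_ge_atTop 0)).exists
    refine ⟨z, hz0, ?_⟩
    rw [id, intervalIntegral.integral_of_le hz0] at hz
    have := integral_Ioi_eq_add le_rfl hz0 hint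
    linarith

/-- The infimum in the definition of `L` is attained. -/
theorem integral_Ioi_tailL_le (hF : IsTailBound F ε) (hε0 : 0 < ε) (hε1 : ε ≤ 1) (hT : 1 ≤ T) :
    ∫ q in Set.Ioi (tailL F ε T), F q ≤ tailQ F ε / √T := by
  have hint := hF.integrableOn hε0 hε1
  -- As `F ≤ 1`, the tail integral is 1-Lipschitz in its lower limit.
  refine le_of_forall_pos_le_add fun δ hδ => ?_
  obtain ⟨z, ⟨hz0, hz⟩, hzδ⟩ := exists_lt_of_csInf_lt (hF.exists_integral_le hε0 hε1 hT)
    (show tailL F ε T < tailL F ε T + δ by linarith)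
  have hLz : tailL F ε T ≤ z := tailL_le hz0 hz
  have h1 := integral_Ioi_eq_add tailL_nonneg hLz hint
  have h2 := integral_Ioc_le (tailL_nonneg (F := F) (ε := ε) (T := T)) hLz
    (fun q hq => (hF.mem q hq).2) hint
  linarith

/-- If `F` vanished at `L`, it would vanish beyond `L`; moving `L` left by up to `Q_{F,ε}/√T` would
then keep the tail integral admissible, as `F ≤ 1`. -/
theorem apply_tailL_pos (hF : IsTailBound F ε) (hε0 : 0 < ε) (hε1 : ε ≤ 1) (hT : 1 ≤ T)
    (hL : 0 < tailL F ε T) : 0 < F (tailL F ε T) := by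
  refine lt_of_le_of_ne (hF.mem _ hL).1 fun h0 => ?_
  have hint := hF.integrableOn hε0 hε1
  have hT' : (0 : ℝ) < √T := Real.sqrt_pos.2 (by exact_mod_cast hT)
  have hQ : 0 < tailQ F ε / √T := div_pos (hF.tailQ_pos hε0 hε1 hL) hT'
  set z := max 0 (tailL F ε T - tailQ F ε / √T) with hz
  have hz0 : 0 ≤ z := le_max_left _ _
  have hzL : z < tailL F ε T := max_lt hL (by linarith)
  refine absurd (tailL_le hz0 ?_) (not_le.2 hzL)
  have h1 : ∫ q in Set.Ioi (tailL F ε T), F q = 0 :=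
    setIntegral_eq_zero_of_forall_eq_zero fun q hq =>
      le_antisymm ((hF.anti hL (hL.trans hq) (le_of_lt hq)).trans h0.ge) (hF.mem q (hL.trans hq)).1
  rw [integral_Ioi_eq_add hz0 hzL.le hint, h1, add_zero]
  refine (integral_Ioc_le hz0 hzL.le (fun q hq => (hF.mem q hq).2) hint).trans ?_
  linarith [le_max_right 0 (tailL F ε T - tailQ F ε / √T)]

theorem tailL_pos_of_numThresholds_ne_zero (h : numThresholds F ε T ≠ 0) : 0 < tailL F ε T := by
  refine lt_of_le_of_ne tailL_nonneg fun h0 => h ?_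
  simp [numThresholds, ← h0]

/-- The mesh of the thresholds. -/
theorem mesh_le (hF : IsTailBound F ε) (hε0 : 0 < ε) (hε1 : ε ≤ 1) (hT : 1 ≤ T)
    (hm : numThresholds F ε T ≠ 0) :
    tailL F ε T / numThresholds F ε T ≤ 2 * (tailQ F ε / √T) := by
  have hL := tailL_pos_of_numThresholds_ne_zero hm
  have hQ := hF.tailQ_pos hε0 hε1 hL
  have hT' : (0 : ℝ) < √T := Real.sqrt_pos.2 (by exact_mod_cast hT)
  -- The factor `2` absorbs the floor: `m + 1 ≤ 2 * m` for `m ≥ 1`.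
  have h1 : tailL F ε T * √T / tailQ F ε < numThresholds F ε T + 1 := Nat.lt_floor_add_one _
  have h2 : (1 : ℝ) ≤ numThresholds F ε T := by exact_mod_cast Nat.one_le_iff_ne_zero.2 hm
  rw [div_lt_iff₀ hQ] at h1
  rw [div_le_iff₀ (by linarith), mul_div_assoc', div_mul_eq_mul_div, le_div_iff₀ hT']
  nlinarith

theorem tailL_le_of_numThresholds_eq_zero (hF : IsTailBound F ε) (hε0 : 0 < ε) (hε1 : ε ≤ 1)
    (hT : 1 ≤ T) (hm : numThresholds F ε T = 0) : tailL F ε T ≤ tailQ F ε / √T := by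
  rcases (tailL_nonneg (F := F) (ε := ε) (T := T)).eq_or_lt with h0 | hL
  · rw [← h0]
    exact div_nonneg (tailQ_nonneg hε0) (Real.sqrt_nonneg _)
  · have hQ := hF.tailQ_pos hε0 hε1 hL
    have hT' : (0 : ℝ) < √T := Real.sqrt_pos.2 (by exact_mod_cast hT)
    have h1 := Nat.floor_eq_zero.1 hm
    rw [div_lt_one hQ] at h1
    rw [le_div_iff₀ hT']
    exact h1.le

theorem threshold_eq (i : Fin (numThresholds F ε T)) :
    threshold F ε T i = ((i : ℕ) + 1) * (tailL F ε T / numThresholds F ε T) := rfl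

theorem threshold_pos (i : Fin (numThresholds F ε T)) : 0 < threshold F ε T i := by
  have hm : numThresholds F ε T ≠ 0 := (Fin.pos i).ne'
  have := tailL_pos_of_numThresholds_ne_zero hm
  rw [threshold_eq]
  positivity

theorem threshold_le (i : Fin (numThresholds F ε T)) : threshold F ε T i ≤ tailL F ε T := by
  have hm : (0 : ℝ) < numThresholds F ε T := by exact_mod_cast Fin.pos i
  have hi : ((i : ℕ) : ℝ) + 1 ≤ numThresholds F ε T := by exact_mod_cast i.2
  rw [threshold_eq, mul_div_assoc', div_le_iff₀ hm]
  nlinarith [tailL_nonneg (F := F) (ε := ε) (T := T)]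

theorem apply_threshold_pos (hF : IsTailBound F ε) (hε0 : 0 < ε) (hε1 : ε ≤ 1) (hT : 1 ≤ T)
    (i : Fin (numThresholds F ε T)) : 0 < F (threshold F ε T i) := by
  have hL := tailL_pos_of_numThresholds_ne_zero (Fin.pos i).ne'
  exact (hF.apply_tailL_pos hε0 hε1 hT hL).trans_le
    (hF.anti (threshold_pos i) hL (threshold_le i))

/-- The errors of the runs of binary product estimation add up to the target error. -/
theorem sum_min_le_tailQ (hF : IsTailBound F ε) (hε0 : 0 < ε) :
    ∑ i, min ε (√(ε * F (threshold F ε T i))) * (tailL F ε T / numThresholds F ε T)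
      ≤ tailQ F ε := by
  rcases eq_or_ne (numThresholds F ε T) 0 with hm | hm
  · rw [Finset.sum_eq_zero fun i _ => absurd hm (Fin.pos i).ne']
    exact tailQ_nonneg hε0
  · have hL := tailL_pos_of_numThresholds_ne_zero hm
    simp only [threshold_eq]
    rw [Fin.sum_univ_eq_sum_range (fun i : ℕ =>
      min ε (√(ε * F (((i : ℕ) + 1) * (tailL F ε T / numThresholds F ε T))))
        * (tailL F ε T / numThresholds F ε T))]
    refine (riemann_sum_le_integral (hF.antitoneOn_min hε0) hF.integrable_min
      (by positivity) _).trans ?_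
    exact setIntegral_mono_set hF.integrable_min
      ((ae_restrict_mem measurableSet_Ioi).mono fun q _ => le_min hε0.le (Real.sqrt_nonneg _))
      (Filter.Eventually.of_forall fun q hq => hq.1)

/-- The Riemann sum over the thresholds approximates the integral of a function below `F`. -/
theorem integral_sub_sum_mem (hF : IsTailBound F ε) (hε0 : 0 < ε) (hε1 : ε ≤ 1) (hT : 1 ≤ T)
    {G : ℝ → ℝ} (hG : AntitoneOn G (Set.Ioi 0)) (hG0 : ∀ q, 0 < q → 0 ≤ G q)
    (hGF : ∀ q, 0 < q → G q ≤ F q) :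
    (∫ q in Set.Ioi 0, G q)
        - ∑ i, G (threshold F ε T i) * (tailL F ε T / numThresholds F ε T)
      ∈ Set.Icc 0 (3 * (tailQ F ε / √T)) := by
  have hint := hF.integrableOn hε0 hε1
  have hGint : IntegrableOn G (Set.Ioi 0) := by
    refine Integrable.mono' hint
      (aemeasurable_restrict_of_antitoneOn measurableSet_Ioi hG).aestronglyMeasurable
      ((ae_restrict_mem measurableSet_Ioi).mono fun q hq => ?_)
    rw [Real.norm_of_nonneg (hG0 q hq)]
    exact hGF q hq
  have hG1 : ∀ q, 0 < q → G q ≤ 1 := fun q hq => (hGF q hq).trans (hF.mem q hq).2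
  have hL0 := tailL_nonneg (F := F) (ε := ε) (T := T)
  have hsplit := integral_Ioi_eq_add le_rfl hL0 hGint
  have htail0 : 0 ≤ ∫ q in Set.Ioi (tailL F ε T), G q :=
    setIntegral_nonneg measurableSet_Ioi fun q hq => hG0 q (lt_of_le_of_lt hL0 hq)
  have htail : ∫ q in Set.Ioi (tailL F ε T), G q ≤ tailQ F ε / √T := by
    refine le_trans ?_ (hF.integral_Ioi_tailL_le hε0 hε1 hT)
    have hsub : Set.Ioi (tailL F ε T) ⊆ Set.Ioi 0 := Set.Ioi_subset_Ioi hL0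
    exact setIntegral_mono_on (hGint.mono_set hsub) (hint.mono_set hsub) measurableSet_Ioi
      fun q hq => hGF q (hsub hq)
  have hQT : 0 ≤ tailQ F ε / √T := div_nonneg (tailQ_nonneg hε0) (Real.sqrt_nonneg _)
  rcases eq_or_ne (numThresholds F ε T) 0 with hm | hm
  · rw [Finset.sum_eq_zero fun i _ => absurd hm (Fin.pos i).ne', sub_zero]
    have h1 := integral_Ioc_le le_rfl hL0 hG1 hGint
    have h2 := hF.tailL_le_of_numThresholds_eq_zero hε0 hε1 hT hm
    exact ⟨setIntegral_nonneg measurableSet_Ioi hG0, by linarith⟩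
  · have hL := tailL_pos_of_numThresholds_ne_zero hm
    have hmesh := hF.mesh_le hε0 hε1 hT hm
    set h := tailL F ε T / numThresholds F ε T with hh
    have hh0 : 0 < h := by positivity
    have hmh : numThresholds F ε T * h = tailL F ε T := by rw [hh]; field_simp
    simp only [threshold_eq]
    rw [← hh, Fin.sum_univ_eq_sum_range (fun i : ℕ => G ((i + 1) * h) * h)]
    have h1 := riemann_sum_le_integral hG hGint hh0 (numThresholds F ε T)
    rw [hmh] at h1
    -- The upper bound needs only the first `m - 1` thresholds to cover `(0, L]`. The error is then
    -- one mesh, at most `2 * (tailQ F ε / √T)`, plus the truncated tail.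
    obtain ⟨k, hk⟩ := Nat.exists_eq_succ_of_ne_zero hm
    have h2 := integral_le_riemann_sum hG hG1 hGint hh0 k
    have h3 : ((k : ℝ) + 1) * h = tailL F ε T := by
      rw [← hmh, hk]; push_cast; ring
    rw [h3] at h2
    have h4 : ∑ i ∈ Finset.range k, G ((i + 1) * h) * h
        ≤ ∑ i ∈ Finset.range (numThresholds F ε T), G ((i + 1) * h) * h := by
      rw [hk, Finset.sum_range_succ]
      have := hG0 ((k + 1) * h) (by positivity)
      nlinarith
    constructor <;> linarith

end IsTailBound

/-! ### The mean as an integral of tails -/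

section Mean

variable {T : ℕ} {F : ℝ → ℝ} {ε : ℝ} {P : Measure (Fin T → ℝ)}

/-- The bit `1{x ≥ q}` or `1{x ≤ -q}`. -/
noncomputable def thresholdBit (q : ℝ) : Bool → ℝ → Bool
  | true, x => decide (q ≤ x)
  | false, x => decide (x ≤ -q)

theorem measurable_thresholdBit (q : ℝ) (b : Bool) : Measurable (thresholdBit q b) := by
  refine measurable_to_bool ?_
  cases b
  · have : thresholdBit q false ⁻¹' {true} = Set.Iic (-q) := by ext; simp [thresholdBit]
    rw [this]
    exact measurableSet_Iic
  · have : thresholdBit q true ⁻¹' {true} = Set.Ici q := by ext; simp [thresholdBit]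
    rw [this]
    exact measurableSet_Ici

/-- The probability of the tail of coordinate `t`, upper or lower according to the flag. -/
noncomputable def tailProb (P : Measure (Fin T → ℝ)) (t : Fin T) (b : Bool) (q : ℝ) : ℝ :=
  P.real {x | thresholdBit q b (x t) = true}

theorem antitoneOn_tailProb [IsProbabilityMeasure P] (t : Fin T) (b : Bool) :
    AntitoneOn (tailProb P t b) (Set.Ioi 0) := by
  intro q _ q' _ hqq'
  refine measureReal_mono fun x hx => ?_
  cases b
  · simp only [thresholdBit, decide_eq_true_eq, Set.mem_ofPred_eq] at hx ⊢
    linarith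
  · simp only [thresholdBit, decide_eq_true_eq, Set.mem_ofPred_eq] at hx ⊢
    linarith

theorem IsTailBoundProduct.tailProb_le (hP : IsTailBoundProduct F P) (hF : IsTailBound F ε)
    (t : Fin T) (b : Bool) {q : ℝ} (hq : 0 < q) : tailProb P t b q ≤ F q := by
  have := hP.prob
  refine ENNReal.toReal_le_of_le_ofReal (hF.mem q hq).1 (le_trans (measure_mono ?_) (hP.tail t q hq))
  intro x hx
  cases b
  · simp only [thresholdBit, decide_eq_true_eq, Set.mem_ofPred_eq] at hx ⊢
    exact le_abs.2 (Or.inr (by linarith))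
  · simp only [thresholdBit, decide_eq_true_eq, Set.mem_ofPred_eq] at hx ⊢
    exact le_abs.2 (Or.inl hx)

theorem IsTailBoundProduct.integrable (hP : IsTailBoundProduct F P) (hF : IsTailBound F ε)
    (hε0 : 0 < ε) (hε1 : ε ≤ 1) (t : Fin T) : Integrable (fun x => x t) P := by
  have hm : Measurable fun x : Fin T → ℝ => x t := measurable_pi_apply t
  refine ⟨hm.aestronglyMeasurable, ?_⟩
  rw [hasFiniteIntegral_iff_norm]
  simp only [Real.norm_eq_abs]
  rw [lintegral_eq_lintegral_meas_le P (ae_of_all _ fun x => abs_nonneg _)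
    hm.abs.aemeasurable]
  calc ∫⁻ q in Set.Ioi 0, P {x | q ≤ |x t|} ≤ ∫⁻ q in Set.Ioi 0, ENNReal.ofReal (F q) :=
        setLIntegral_mono' measurableSet_Ioi fun q hq => hP.tail t q hq
    _ < ⊤ := (hF.integrableOn hε0 hε1).lintegral_lt_top

theorem IsTailBoundProduct.mean_eq (hP : IsTailBoundProduct F P) (hF : IsTailBound F ε)
    (hε0 : 0 < ε) (hε1 : ε ≤ 1) (t : Fin T) :
    mean P t = (∫ q in Set.Ioi 0, tailProb P t true q) - ∫ q in Set.Ioi 0, tailProb P t false q := by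
  have hint := hP.integrable hF hε0 hε1 t
  have h1 := hint.pos_part.integral_eq_integral_meas_le (ae_of_all _ fun x => le_max_right _ _)
  have h2 := hint.neg_part.integral_eq_integral_meas_le (ae_of_all _ fun x => le_max_right _ _)
  -- For `q > 0` the truncation at `0` in the positive part does not affect the event; likewise for
  -- the negative part.
  have h3 : ∫ q in Set.Ioi 0, tailProb P t true q
      = ∫ q in Set.Ioi 0, P.real {x | q ≤ max (x t) 0} := by
    refine setIntegral_congr_fun measurableSet_Ioi fun q hq => ?_
    have hq : 0 < q := hq
    unfold tailProb
    congr 1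
    ext x
    simp [thresholdBit, hq]
  have h4 : ∫ q in Set.Ioi 0, tailProb P t false q
      = ∫ q in Set.Ioi 0, P.real {x | q ≤ max (-x t) 0} := by
    refine setIntegral_congr_fun measurableSet_Ioi fun q hq => ?_
    have hq : 0 < q := hq
    unfold tailProb
    congr 1
    ext x
    simp [thresholdBit, hq, le_neg]
  rw [h3, h4, ← h1, ← h2, ← integral_sub hint.pos_part hint.neg_part]
  refine integral_congr_ae (ae_of_all _ fun x => ?_)
  simp only
  rcases le_total (x t) 0 with h | h
  · rw [max_eq_right h, max_eq_left (by linarith)]; ring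
  · rw [max_eq_left h, max_eq_right (by linarith)]; ring

/-- The discretization error. -/
theorem IsTailBoundProduct.abs_sum_sub_mean_le (hP : IsTailBoundProduct F P) (hF : IsTailBound F ε)
    (hε0 : 0 < ε) (hε1 : ε ≤ 1) (hT : 1 ≤ T) (t : Fin T) :
    |∑ i, (tailProb P t true (threshold F ε T i) - tailProb P t false (threshold F ε T i))
        * (tailL F ε T / numThresholds F ε T) - mean P t| ≤ 3 * (tailQ F ε / √T) := by
  have := hP.prob
  have h := fun b => hF.integral_sub_sum_mem hε0 hε1 hT (antitoneOn_tailProb (P := P) t b)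
    (fun q _ => measureReal_nonneg) (fun q hq => hP.tailProb_le hF t b hq)
  obtain ⟨h1, h2⟩ := h true
  obtain ⟨h3, h4⟩ := h false
  simp only [sub_mul, Finset.sum_sub_distrib]
  -- Both discretization errors are nonnegative, so their difference is no larger than the worse
  -- one.
  rw [hP.mean_eq hF hε0 hε1, abs_le]
  constructor <;> linarith

end Mean

/-! ### The Euclidean norm -/

section Norm

variable {T : ℕ}

theorem sqrt_sum_sq_eq_norm (v : Fin T → ℝ) : √(∑ t, v t ^ 2) = ‖WithLp.toLp 2 v‖ := by
  simp [EuclideanSpace.norm_eq]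

theorem sqrt_sum_sq_add_le (v w : Fin T → ℝ) :
    √(∑ t, (v t + w t) ^ 2) ≤ √(∑ t, v t ^ 2) + √(∑ t, w t ^ 2) := by
  rw [sqrt_sum_sq_eq_norm v, sqrt_sum_sq_eq_norm w, sqrt_sum_sq_eq_norm fun t => v t + w t]
  exact norm_add_le (WithLp.toLp 2 v) (WithLp.toLp 2 w)

theorem sqrt_sum_sq_sum_mul_le {ι : Type*} [Fintype ι] (v : ι → Fin T → ℝ) {h : ℝ} (hh : 0 ≤ h) :
    √(∑ t, (∑ i, v i t * h) ^ 2) ≤ ∑ i, √(∑ t, v i t ^ 2) * h := by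
  have h1 : WithLp.toLp 2 (fun t => ∑ i, v i t * h) = ∑ i, h • WithLp.toLp 2 (v i) := by
    ext t
    simp [mul_comm]
  rw [sqrt_sum_sq_eq_norm fun t => ∑ i, v i t * h, h1]
  refine (norm_sum_le _ _).trans (Finset.sum_le_sum fun i _ => ?_)
  rw [norm_smul, sqrt_sum_sq_eq_norm, Real.norm_of_nonneg hh, mul_comm]

theorem sqrt_sum_sq_le_of_abs_le {v : Fin T → ℝ} {c : ℝ} (hc : 0 ≤ c) (hv : ∀ t, |v t| ≤ c) :
    √(∑ t, v t ^ 2) ≤ √T * c := by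
  rw [Real.sqrt_le_iff]
  refine ⟨by positivity, ?_⟩
  rw [mul_pow, Real.sq_sqrt (Nat.cast_nonneg _)]
  calc ∑ t, v t ^ 2 ≤ ∑ _ : Fin T, c ^ 2 := Finset.sum_le_sum fun t _ => by
        rw [← sq_abs]
        exact pow_le_pow_left₀ (abs_nonneg _) (hv t) 2
    _ = _ := by simp

end Norm

/-! ### Non-parametric estimation -/

section Main

variable {T n : ℕ} {F : ℝ → ℝ} {ε : ℝ} {P : Measure (Fin T → ℝ)}

/-- The samples and seeds for which the noisy clean bits of one run of binary product estimation
are not typical. -/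
def atypical (F : ℝ → ℝ) (ε : ℝ) (P : Measure (Fin T → ℝ))
    (i : Fin (numThresholds F ε T)) (b : Bool) :
    Set ((Fin n → Fin T → ℝ) × (nonParametricEstimation F ε T n).Seed) :=
  {z | 2 * ε < ∑ a, |patternFreq (noisyBits (F (threshold F ε T i))
      (thresholdBit (threshold F ε T i) b) (z.1, z.2 i b)) a
    - patternProb (fun t => F (threshold F ε T i) / 4 + tailProb P t b (threshold F ε T i) / 2) a|}

/-- One run uses only the block `(i, b)` of the seed, whose noisy clean bits are i.i.d. patterns, so
concentration applies with `2^T` patterns and hence `2^(2^T)` sets. -/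
theorem measure_atypical_le (hP : IsTailBoundProduct F P) (hF : IsTailBound F ε) (hε0 : 0 < ε)
    (hn : n ≠ 0) (i : Fin (numThresholds F ε T)) (b : Bool) :
    ((Measure.pi fun _ : Fin n => P).prod (nonParametricEstimation F ε T n).law)
        (atypical F ε P i b) ≤ ENNReal.ofReal (2 ^ 2 ^ T * Real.exp (-(2 * n * ε ^ 2))) := by
  have := hP.prob
  set q := threshold F ε T i with hq
  have hγ := hF.mem q (IsTailBound.threshold_pos i)
  have hφ := measurable_thresholdBit q b
  have hPt : ∀ t : Fin T, IsProbabilityMeasure (P.map fun x => x t) := fun t =>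
    Measure.isProbabilityMeasure_map (measurable_pi_apply t).aemeasurable
  set ν : Measure (Fin T → Bool) :=
    Measure.pi fun t => noisyBitLaw (F q) (thresholdBit q b) (P.map fun x => x t) with hν
  have hmeas : Measurable fun z : ℝ × unitInterval => addNoise (F q) z.2 (thresholdBit q b z.1) :=
    (measurable_addNoise (F q)).comp ((hφ.comp measurable_fst).prodMk measurable_snd)
  have hB : ∀ t : Fin T, IsProbabilityMeasure
      (noisyBitLaw (F q) (thresholdBit q b) (P.map fun x => x t)) :=
    fun t => Measure.isProbabilityMeasure_map hmeas.aemeasurable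
  have hsing : ∀ a, ν.real {a} = patternProb (fun t => F q / 4 + tailProb P t b q / 2) a := by
    intro a
    rw [hν, noisyPatternLaw_singleton hγ.1 hγ.2 hφ]
    congr 1
    ext t
    rw [map_measureReal_apply (measurable_pi_apply t) (hφ (measurableSet_singleton true))]
    rfl
  have hseed : MeasurePreserving
      (fun ω : Fin (numThresholds F ε T) → Bool → Fin n → Fin T → unitInterval => ω i b)
      volume volume :=
    (measurePreserving_eval (fun _ : Bool => (volume : Measure (Fin n → Fin T → unitInterval)))
      b).comp (measurePreserving_eval (fun _ : Fin (numThresholds F ε T) =>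
        (volume : Measure (Bool → Fin n → Fin T → unitInterval))) i)
  have hmp : MeasurePreserving
      (fun z : (Fin n → Fin T → ℝ) × (nonParametricEstimation F ε T n).Seed =>
        noisyBits (F q) (thresholdBit q b) (z.1, z.2 i b))
      ((Measure.pi fun _ : Fin n => P).prod (nonParametricEstimation F ε T n).law)
      (Measure.pi fun _ : Fin n => ν) :=
    (measurePreserving_noisyBits hP.indep (F q) hφ).comp ((MeasurePreserving.id _).prod hseed)
  have hconc := measureReal_freq_le ν n hn hε0
  simp only [hsing, Fintype.card_fun, Fintype.card_bool, Fintype.card_fin] at hconc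
  have hset := hmp.measure_preimage (s := {z : Fin n → Fin T → Bool | 2 * ε <
      ∑ a, |((Finset.univ.filter fun j => z j = a).card : ℝ) / n
        - patternProb (fun t => F q / 4 + tailProb P t b q / 2) a|})
    (Set.toFinite _).measurableSet.nullMeasurableSet
  refine le_trans (le_of_eq hset) ?_
  rw [← ofReal_measureReal]
  exact ENNReal.ofReal_le_ofReal hconc

/-- On typical samples and seeds the estimator is accurate for every corruption. -/
theorem sqrt_sum_sq_run_sub_mean_le (hP : IsTailBoundProduct F P) (hF : IsTailBound F ε)
    (hε0 : 0 < ε) (hε1 : ε ≤ 1 / 512) (hT : 1 ≤ T) (hn : numThresholds F ε T ≠ 0 → n ≠ 0)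
    {c x : Fin n → Fin T → ℝ} {ω : (nonParametricEstimation F ε T n).Seed}
    (hω : ∀ i b, (c, ω) ∉ atypical F ε P i b) (hx : IsCorruption ε c x) :
    √(∑ t, ((nonParametricEstimation F ε T n).run ω x t - mean P t) ^ 2)
      ≤ 2051 * tailQ F ε := by
  have := hP.prob
  have hε1' : ε ≤ 1 := by linarith
  set h := tailL F ε T / numThresholds F ε T with hh
  have hh0 : 0 ≤ h := div_nonneg IsTailBound.tailL_nonneg (Nat.cast_nonneg _)
  set E : Bool → Fin (numThresholds F ε T) → Fin T → ℝ := fun b i t =>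
    binaryProductEstimation (F (threshold F ε T i)) (ω i b)
      (fun j (s : {s : Fin T // s ≤ t}) => thresholdBit (threshold F ε T i) b (x j s.1))
      - tailProb P t b (threshold F ε T i) with hE
  have hEle : ∀ b i, √(∑ t, E b i t ^ 2) ≤ 1024 * min ε √(ε * F (threshold F ε T i)) := by
    intro b i
    have hq := IsTailBound.threshold_pos i
    refine sqrt_sum_sq_binaryProductEstimation_le (hn (Fin.pos i).ne')
      (hF.apply_threshold_pos hε0 hε1' hT i) (hF.mem _ hq).2 hε0 hε1
      (fun t => ⟨measureReal_nonneg, hP.tailProb_le hF t b hq⟩) (ω i b)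
      (fun j t => thresholdBit (threshold F ε T i) b (c j t))
      (fun j t => thresholdBit (threshold F ε T i) b (x j t)) ?_ (not_lt.1 (hω i b))
    have hsub : {j | (fun t => thresholdBit (threshold F ε T i) b (x j t))
        ≠ fun t => thresholdBit (threshold F ε T i) b (c j t)} ⊆ {j | x j ≠ c j} := by
      intro j hj hxc
      exact hj (by rw [hxc])
    have hcard := Set.ncard_le_ncard hsub (Set.toFinite _)
    refine le_trans ?_ hx
    exact_mod_cast hcard
  set D : Fin T → ℝ := fun t =>
    ∑ i, (tailProb P t true (threshold F ε T i) - tailProb P t false (threshold F ε T i)) * h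
      - mean P t with hD
  -- The errors of the upper runs, the lower runs and the discretization contribute `1024 + 1024 + 3
  -- = 2051` times `tailQ F ε`.
  have hdecomp : ∀ t, (nonParametricEstimation F ε T n).run ω x t - mean P t
      = (∑ i, E true i t * h + ∑ i, -E false i t * h) + D t := by
    intro t
    have hrun : (nonParametricEstimation F ε T n).run ω x t
        = ∑ i, (E true i t + tailProb P t true (threshold F ε T i)) * h
          - ∑ i, (E false i t + tailProb P t false (threshold F ε T i)) * h := by
      simp only [hE, sub_add_cancel]
      rfl
    rw [hrun, hD]
    simp only [add_mul, sub_mul, neg_mul, Finset.sum_add_distrib, Finset.sum_sub_distrib,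
      Finset.sum_neg_distrib]
    ring
  simp only [hdecomp]
  refine (sqrt_sum_sq_add_le _ _).trans ?_
  have h1 := sqrt_sum_sq_add_le (fun t => ∑ i, E true i t * h) (fun t => ∑ i, -E false i t * h)
  have h2 : ∀ b, ∑ i, √(∑ t, E b i t ^ 2) * h ≤ 1024 * tailQ F ε := by
    intro b
    calc _ ≤ ∑ i, 1024 * (min ε √(ε * F (threshold F ε T i)) * h) :=
          Finset.sum_le_sum fun i _ => by
            rw [← mul_assoc]
            exact mul_le_mul_of_nonneg_right (hEle b i) hh0
      _ ≤ _ := by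
        rw [← Finset.mul_sum]
        exact mul_le_mul_of_nonneg_left (hF.sum_min_le_tailQ hε0) (by norm_num)
  have h3 := (sqrt_sum_sq_sum_mul_le (E true) hh0).trans (h2 true)
  have h4 : √(∑ t, (∑ i, -E false i t * h) ^ 2) ≤ 1024 * tailQ F ε := by
    have := (sqrt_sum_sq_sum_mul_le (fun i t => -E false i t) hh0)
    simp only [neg_sq] at this
    exact this.trans (h2 false)
  have hQ := IsTailBound.tailQ_nonneg (F := F) hε0
  have hT' : (0 : ℝ) < √T := Real.sqrt_pos.2 (by exact_mod_cast hT)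
  have h5 : √(∑ t, D t ^ 2) ≤ √T * (3 * (tailQ F ε / √T)) :=
    sqrt_sum_sq_le_of_abs_le (by positivity) fun t =>
      hP.abs_sum_sub_mean_le hF hε0 hε1' hT t
  have h6 : √T * (3 * (tailQ F ε / √T)) = 3 * tailQ F ε := by field_simp
  linarith

/-- The number of samples suffices for a union bound over all runs. -/
theorem union_bound_le (hT : 1 ≤ T) {L Q A τ : ℝ} {m : ℕ} (hε0 : 0 < ε) (hτ0 : 0 < τ) (hL : 0 < L)
    (hQ : 0 < Q) (hm : m ≤ L * √T / Q) (hA : 1 / ε ≤ A)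
    (hn : 2 * 2 ^ T * A ^ 2 * max 1 (Real.log (L / (Q * τ))) ≤ n) :
    (m * 2 : ℝ) * (2 ^ 2 ^ T * Real.exp (-(2 * n * ε ^ 2))) ≤ τ := by
  set M := max 1 (Real.log (L / (Q * τ))) with hM
  have hM1 : 1 ≤ M := le_max_left _ _
  set B : ℝ := 2 ^ T with hB
  have hB0 : 0 < B := by positivity
  have hTB : (T : ℝ) + 1 ≤ B := by
    rw [hB]
    exact_mod_cast Nat.succ_le_of_lt (Nat.lt_two_pow_self (n := T))
  have hT1 : (1 : ℝ) ≤ T := by exact_mod_cast hT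
  have hnε : 4 * B * M ≤ 2 * n * ε ^ 2 := by
    have hAε : 1 ≤ A * ε := by rwa [div_le_iff₀ hε0] at hA
    have h1 : 1 ≤ (A * ε) ^ 2 := one_le_pow₀ hAε
    have h2 : 2 * B * A ^ 2 * M * ε ^ 2 ≤ n * ε ^ 2 := by gcongr
    have h3 : B * M * 1 ≤ B * M * (A * ε) ^ 2 := by gcongr
    nlinarith
  have hmτ : (m : ℝ) ≤ τ * (T * Real.exp M) := by
    have h1 : L / (Q * τ) ≤ Real.exp M := by
      rw [← Real.log_le_iff_le_exp (by positivity)]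
      exact le_max_right _ _
    have h2 : √(T : ℝ) ≤ T := Real.sqrt_le_iff.2 ⟨by linarith, by nlinarith⟩
    calc (m : ℝ) ≤ L * √T / Q := hm
      _ = τ * (√T * (L / (Q * τ))) := by field_simp
      _ ≤ τ * (T * Real.exp M) := by gcongr
  have hT2 : (T : ℝ) * 2 ≤ Real.exp (2 * B) := by
    have := Real.add_one_le_exp (2 * B)
    linarith
  have h22 : (2 : ℝ) ^ 2 ^ T ≤ Real.exp B := by
    have h1 : (2 : ℝ) ≤ Real.exp 1 := by
      have := Real.add_one_le_exp 1
      linarith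
    calc (2 : ℝ) ^ 2 ^ T ≤ Real.exp 1 ^ 2 ^ T := by gcongr
      _ = Real.exp B := by rw [← Real.exp_nat_mul]; simp [hB]
  have hexp : Real.exp (-(2 * n * ε ^ 2)) ≤ Real.exp (-(4 * B * M)) :=
    Real.exp_le_exp.2 (by linarith)
  calc (m * 2 : ℝ) * (2 ^ 2 ^ T * Real.exp (-(2 * n * ε ^ 2)))
      ≤ (τ * (T * Real.exp M) * 2) * (Real.exp B * Real.exp (-(4 * B * M))) := by gcongr
    _ = τ * ((T * 2) * (Real.exp M * Real.exp B * Real.exp (-(4 * B * M)))) := by ring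
    _ ≤ τ * (Real.exp (2 * B) * (Real.exp M * Real.exp B * Real.exp (-(4 * B * M)))) := by gcongr
    _ = τ * Real.exp (2 * B + (M + B + -(4 * B * M))) := by simp only [Real.exp_add]
    _ ≤ τ * 1 := by
      gcongr
      rw [Real.exp_le_one_iff]
      -- The exponent is nonpositive because `3 * B + M ≤ 4 * B * M` for `B, M ≥ 1`.
      nlinarith
    _ = τ := mul_one τ

/-- Non-parametric estimation is robust. -/
theorem robustlyEstimatesMean_nonParametricEstimation (hP : IsTailBoundProduct F P)
    (hF : IsTailBound F ε) (hε0 : 0 < ε) (hε1 : ε ≤ 1 / 512) (hT : 1 ≤ T) {τ : ℝ} (hτ0 : 0 < τ)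
    (hn : 0 < tailL F ε T →
      2 * 2 ^ T * (T * (1 / ε) * (1 / F (tailL F ε T))) ^ 2
        * max 1 (Real.log (tailL F ε T / (tailQ F ε * τ))) ≤ n) :
    RobustlyEstimatesMean (nonParametricEstimation F ε T n) P ε (2051 * tailQ F ε) τ := by
  have hε1' : ε ≤ 1 := by linarith
  set μ := (Measure.pi fun _ : Fin n => P).prod (nonParametricEstimation F ε T n).law with hμ
  have hA : 0 < tailL F ε T → 1 / ε ≤ T * (1 / ε) * (1 / F (tailL F ε T)) := by
    intro hL
    have hFL := hF.apply_tailL_pos hε0 hε1' hT hL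
    have h1 : 1 ≤ 1 / F (tailL F ε T) := by
      rw [le_div_iff₀ hFL, one_mul]
      exact (hF.mem _ hL).2
    have h2 : (1 : ℝ) ≤ T := by exact_mod_cast hT
    have h3 : 0 < 1 / ε := by positivity
    calc 1 / ε = 1 * (1 / ε) * 1 := by ring
      _ ≤ _ := by gcongr
  have hn0 : numThresholds F ε T ≠ 0 → n ≠ 0 := by
    rintro hm rfl
    have hL := IsTailBound.tailL_pos_of_numThresholds_ne_zero hm
    have h1 := hn hL
    have h2 := (show 0 < 1 / ε by positivity).trans_le (hA hL)
    have h3 : (0 : ℝ) < max 1 (Real.log (tailL F ε T / (tailQ F ε * τ))) :=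
      lt_max_of_lt_left one_pos
    rw [Nat.cast_zero] at h1
    exact absurd h1 (not_le.2 (by positivity))
  have hsub : {z : (Fin n → Fin T → ℝ) × (nonParametricEstimation F ε T n).Seed |
      ∃ x : Fin n → Fin T → ℝ, IsCorruption ε z.1 x ∧
        2051 * tailQ F ε
          < √(∑ t, ((nonParametricEstimation F ε T n).run z.2 x t - mean P t) ^ 2)}
      ⊆ ⋃ ib : Fin (numThresholds F ε T) × Bool, atypical F ε P ib.1 ib.2 := by
    rintro ⟨c, ω⟩ ⟨x, hx, hlt⟩
    by_contra hcon
    simp only [Set.mem_iUnion, not_exists, Prod.forall] at hcon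
    exact absurd hlt (not_lt.2 (sqrt_sum_sq_run_sub_mean_le hP hF hε0 hε1 hT hn0 hcon hx))
  refine (measure_mono hsub).trans ((measure_iUnion_fintype_le _ _).trans ?_)
  -- Without thresholds there are no runs, so the failure event is empty for every `n`, including `n
  -- = 0`.
  rcases eq_or_ne (numThresholds F ε T) 0 with hm | hm
  · have : IsEmpty (Fin (numThresholds F ε T) × Bool) := by
      rw [hm]; infer_instance
    simp
  · refine (Finset.sum_le_sum fun ib _ =>
      measure_atypical_le hP hF hε0 (hn0 hm) ib.1 ib.2).trans ?_
    have hL := IsTailBound.tailL_pos_of_numThresholds_ne_zero hm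
    rw [Finset.sum_const, nsmul_eq_mul, ← ENNReal.ofReal_natCast,
      ← ENNReal.ofReal_mul (Nat.cast_nonneg _)]
    refine ENNReal.ofReal_le_ofReal ?_
    have := union_bound_le (m := numThresholds F ε T) hT hε0 hτ0 hL (hF.tailQ_pos hε0 hε1' hL)
      (Nat.floor_le (div_nonneg (mul_nonneg hL.le (Real.sqrt_nonneg _))
        (IsTailBound.tailQ_nonneg hε0))) (hA hL) (hn hL)
    simpa only [Finset.card_univ, Fintype.card_prod, Fintype.card_fin, Fintype.card_bool,
      Nat.cast_mul, Nat.cast_ofNat] using this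

end Main

end OnlineRobustMean

theorem theorem4p10 :
    ∃ (ε₀ C K : ℝ) (k : ℕ), 0 < ε₀ ∧ 0 < C ∧ 0 < K ∧
      ∀ (T n : ℕ) (ε τ : ℝ) (F : ℝ → ℝ) (P : Measure (Fin T → ℝ)),
        1 ≤ T → 0 < ε → ε ≤ ε₀ → 0 < τ → τ < 1 →
        AntitoneOn F (Set.Ioi 0) →
        (∀ q : ℝ, 0 < q → 0 ≤ F q ∧ F q ≤ 1) →
        IntegrableOn (fun q : ℝ => min ε (Real.sqrt (ε * F q))) (Set.Ioi 0) →
        OnlineRobustMean.IsTailBoundProduct F P →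
        (0 < OnlineRobustMean.tailL F ε T →
          K * 2 ^ T * (T * (1 / ε) * (1 / F (OnlineRobustMean.tailL F ε T))) ^ k
            * max 1 (Real.log (OnlineRobustMean.tailL F ε T / (OnlineRobustMean.tailQ F ε * τ)))
          ≤ (n : ℝ)) →
        OnlineRobustMean.RobustlyEstimatesMean
          (OnlineRobustMean.nonParametricEstimation F ε T n) P ε
          (C * OnlineRobustMean.tailQ F ε) τ :=
  -- The value of `ε₀` is the condition `4 * ε ≤ 1 / 128` on the ℓ¹ distance; the exponent `2` comes
  -- from `ε ^ 2` in Hoeffding's bound.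
  ⟨1 / 512, 2051, 2, 2, by norm_num, by norm_num, by norm_num,
    fun _ _ _ _ _ _ hT hε0 hε1 hτ0 _ hanti hmem hint hP hn =>
      OnlineRobustMean.robustlyEstimatesMean_nonParametricEstimation hP ⟨hanti, hmem, hint⟩
        hε0 hε1 hT hτ0 hn⟩
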